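/- Graphs are finite and may have loops and parallel edges. A biased graph is a pair $(G,\mathcal B)$, where $G$ is a graph and $\mathcal B$ is a set of cycles of $G$ (the balanced cycles) such that no theta subgraph of $G$ (three internally disjoint paths joining two distinct vertices) contains exactly two balanced cycles. For a group $\Gamma$, $(G,\mathcal B)$ is $\Gamma$-labellable if there are an orientation of the edges of $G$ and a map $\phi:E(G)\to\Gamma$ such that a cycle $C$ is in $\mathcal B$ if and only if some simple closed walk $e_1,\dots,e_\ell$ around $C$ satisfies $\prod_{i=1}^{\ell}\phi(e_i)^{\epsilon_i}=1$, where $\epsilon_i=1$ if $e_i$ is traversed forward and $\epsilon_i=-1$ otherwise. It is group-labellable if it is $\Gamma$-labellable for some group $\Gamma$. Deleting an edge $e$ removes $e$ from $G$ and removes from $\mathcal B$ all cycles containing $e$. Contracting a non-loop edge $e$ contracts $e$ in $G$, and a cycle $C$ of $G/e$ is balanced if $C\in\mathcal B$ or $E(C)\cup\{e\}$ is the edge set of a cycle in $\mathcal B$. Contracting a balanced loop means deleting it. Contracting an unbalanced loop $e$ at a vertex $x$ follows one of two fixed conventions: in the lift convention $e$ is deleted and all remaining cycles become balanced; in the frame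 convention $e$ is deleted, every edge from $x$ to a vertex $w\neq x$ becomes an unbalanced loop at $w$, every other loop at $x$ becomes balanced, and cycles avoiding $x$ keep their status. A proper minor is a biased graph obtained by a nonempty sequence of deletions and contractions. **Theorem.** Let $k\ge 2$ be an integer, and let $t=3$ or $t\ge 5$. There exists a biased graph $(G,\mathcal B)$, where $G$ has no loops, such that 1. the underlying simple graph of $G$ is the cycle $C_t$; 2. any two adjacent vertices of $G$ are joined by exactly $2k$ edges; 3. $(G,\mathcal B)$ is not group-labellable; 4. for every infinite group $\Gamma$, and under either convention for contracting unbalanced loops, every proper minor of $(G,\mathcal B)$ is $\Gamma$-labellable. -/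

import Mathlib

universe u v

open scoped Graph

namespace Graph

variable {α β : Type*}

/-- `G.IsWalk x L y`: the list `L` of steps `(edge, next vertex)` describes a walk in `G`
from `x` to `y`. -/
def IsWalk (G : Graph α β) : α → List (β × α) → α → Prop
  | x, [], y => x ∈ V(G) ∧ x = y
  | x, (e, z) :: L, y => G.IsLink e x z ∧ G.IsWalk z L y

/-- The set of edges used by a list of steps. -/
def stepEdges (L : List (β × α)) : Set β := {e | e ∈ L.map Prod.fst}

/-- A simple closed walk based at `x`: nonempty, no repeated edge, and no repeated vertex apart
from the return to `x`. A loop gives one of length 1, a pair of parallel edges one of length 2. -/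
structure IsSimpleClosedWalk (G : Graph α β) (x : α) (L : List (β × α)) : Prop where
  isWalk : G.IsWalk x L x
  ne_nil : L ≠ []
  edges_nodup : (L.map Prod.fst).Nodup
  vertices_nodup : (L.map Prod.snd).Nodup

/-- `C` is (the edge set of) a cycle of `G`. A cycle is determined by its edge set. -/
def IsCycle (G : Graph α β) (C : Set β) : Prop :=
  ∃ x L, G.IsSimpleClosedWalk x L ∧ stepEdges L = C

/-- A path from `x` to `y`: a walk without repeated vertices. -/
structure IsPath (G : Graph α β) (x : α) (L : List (β × α)) (y : α) : Prop where
  isWalk : G.IsWalk x L y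
  vertices_nodup : (x :: L.map Prod.snd).Nodup

/-- Two paths from a common start to `y` are internally disjoint (and distinct): they share no
edge, and `y` is the only vertex that both visit after the start. -/
def InternallyDisjoint (y : α) (L M : List (β × α)) : Prop :=
  Disjoint (stepEdges L) (stepEdges M) ∧
    ∀ z, z ∈ L.map Prod.snd → z ∈ M.map Prod.snd → z = y

/-- Three internally disjoint paths `P`, `Q`, `R` between distinct vertices `x`, `y`:
a theta subgraph of `G`. Its cycles are the unions of two of the three paths. -/
structure IsTheta (G : Graph α β) (x y : α) (P Q R : List (β × α)) : Prop where
  ne : x ≠ y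
  isPath₁ : G.IsPath x P y
  isPath₂ : G.IsPath x Q y
  isPath₃ : G.IsPath x R y
  disjoint₁₂ : InternallyDisjoint y P Q
  disjoint₁₃ : InternallyDisjoint y P R
  disjoint₂₃ : InternallyDisjoint y Q R

/-- A group labelling of `G`: an orientation of the edges together with a label in `Γ` for each
edge. The values outside `E(G)` are irrelevant. -/
structure GroupLabelling (G : Graph α β) (Γ : Type*) where
  tail : β → α
  head : β → α
  isLink : ∀ e ∈ E(G), G.IsLink e (tail e) (head e)
  label : β → Γ

open Classical in
/-- The value `φ(W)` of a walk starting at `x`: the product, in order, of the labels of its edges,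
inverted where the edge is traversed backward. (A loop is read forward; whether the closed walk
along a single loop has value `1` does not depend on this.) -/
noncomputable def GroupLabelling.value {G : Graph α β} {Γ : Type*} [Group Γ]
    (φ : G.GroupLabelling Γ) : α → List (β × α) → Γ
  | _, [] => 1
  | x, (e, z) :: L => (if φ.tail e = x then φ.label e else (φ.label e)⁻¹) * φ.value z L

/-- The set of cycles `C` of `G` such that some simple closed walk around `C` has value `1`. -/
def GroupLabelling.balancedCycles {G : Graph α β} {Γ : Type*} [Group Γ]
    (φ : G.GroupLabelling Γ) : Set (Set β) :=
  {C | ∃ x L, G.IsSimpleClosedWalk x L ∧ stepEdges L = C ∧ φ.value x L = 1}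

open Classical in
/-- Contraction of an edge `e` with ends `x`, `y`: delete `e` and identify `y` with `x`. -/
noncomputable def contractLink (G : Graph α β) (e : β) (x y : α) : Graph α β :=
  (G.deleteEdges {e}).map (fun z ↦ if z = y then x else z)

/-- The graph of the frame contraction of an unbalanced loop `e` at `x`: delete `e`, and replace
every edge joining `x` to a vertex `w ≠ x` by a loop at `w`. -/
def contractLoopFrame (G : Graph α β) (e : β) (x : α) : Graph α β where
  vertexSet := V(G)
  IsLink f y z := f ≠ e ∧ ((G.IsLink f y z ∧ y ≠ x ∧ z ≠ x) ∨ (G.IsLoopAt f x ∧ y = x ∧ z = x) ∨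
    (G.IsLink f x y ∧ y ≠ x ∧ z = y))
  isLink_symm f _ := ⟨by
    rintro y z ⟨hf, ⟨h, hy, hz⟩ | ⟨h, rfl, rfl⟩ | ⟨h, hy, rfl⟩⟩
    · exact ⟨hf, Or.inl ⟨h.symm, hz, hy⟩⟩
    · exact ⟨hf, Or.inr (Or.inl ⟨h, rfl, rfl⟩)⟩
    · exact ⟨hf, Or.inr (Or.inr ⟨h, hy, rfl⟩)⟩⟩
  eq_or_eq_of_isLink_of_isLink := by
    rintro f a b c d ⟨-, h⟩ ⟨-, h'⟩
    simp only [Graph.IsLoopAt] at h h'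
    rcases h with ⟨h, ha, hb⟩ | ⟨h, ha, hb⟩ | ⟨h, ha, hb⟩ <;>
      rcases h' with ⟨h', hc, hd⟩ | ⟨h', hc, hd⟩ | ⟨h', hc, hd⟩ <;>
      have := h.eq_and_eq_or_eq_and_eq h' <;> grind
  left_mem_of_isLink := by
    rintro f y z ⟨-, ⟨h, -⟩ | ⟨h, rfl, -⟩ | ⟨h, -⟩⟩
    · exact h.left_mem
    · exact h.left_mem
    · exact h.right_mem

end Graph

/-- A graph (loops and parallel edges allowed) with a distinguished collection of sets of edges,
meant to be the edge sets of the balanced cycles. -/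
structure MarkedGraph (α β : Type*) where
  graph : Graph α β
  balanced : Set (Set β)

/-- The two conventions for contracting an unbalanced loop. -/
inductive LoopRule
  | lift
  | frame

namespace MarkedGraph

variable {α β : Type*}

/-- `Ω` is a biased graph: the graph is finite, the distinguished sets are cycles, and no theta
subgraph has exactly two balanced cycles. (The paths of a theta subgraph can be listed in any
order, so the implication below excludes each of the three ways to have exactly two.) -/
structure IsBiased (Ω : MarkedGraph α β) : Prop where
  finite_vertexSet : V(Ω.graph).Finite
  finite_edgeSet : E(Ω.graph).Finite
  isCycle : ∀ C ∈ Ω.balanced, Ω.graph.IsCycle C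
  theta : ∀ x y P Q R, Ω.graph.IsTheta x y P Q R →
    Graph.stepEdges P ∪ Graph.stepEdges Q ∈ Ω.balanced →
    Graph.stepEdges P ∪ Graph.stepEdges R ∈ Ω.balanced →
    Graph.stepEdges Q ∪ Graph.stepEdges R ∈ Ω.balanced

/-- `Ω` is `Γ`-labellable: some group labelling has exactly the given balanced cycles. -/
def Labellable (Ω : MarkedGraph α β) (Γ : Type*) [Group Γ] : Prop :=
  ∃ φ : Ω.graph.GroupLabelling Γ, φ.balancedCycles = Ω.balanced

/-- `Ω` is `Γ`-labellable for some group `Γ`. -/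
def GroupLabellable (Ω : MarkedGraph α β) : Prop :=
  ∃ (Γ : Type u) (_ : Group Γ), Ω.Labellable Γ

/-- Deletion of the edge `e`. -/
def delete (Ω : MarkedGraph α β) (e : β) : MarkedGraph α β where
  graph := Ω.graph.deleteEdges {e}
  balanced := {C | C ∈ Ω.balanced ∧ e ∉ C}

/-- Contraction of a non-loop edge `e` with ends `x`, `y`. -/
noncomputable def contractLink (Ω : MarkedGraph α β) (e : β) (x y : α) : MarkedGraph α β where
  graph := Ω.graph.contractLink e x y
  balanced := {C | (Ω.graph.contractLink e x y).IsCycle C ∧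
    (C ∈ Ω.balanced ∨ C ∪ {e} ∈ Ω.balanced)}

/-- Contraction of an unbalanced loop `e` at `x`. In the lift convention `e` is deleted and every
remaining cycle becomes balanced. In the frame convention `e` is deleted, every edge from `x` to
another vertex `w` becomes an unbalanced loop at `w`, and the other loops at `x` become balanced;
cycles that avoid `x` are balanced if and only if they were. -/
def contractLoop (Ω : MarkedGraph α β) (e : β) (x : α) : LoopRule → MarkedGraph α β
  | .lift =>
    { graph := Ω.graph.deleteEdges {e}
      balanced := {C | (Ω.graph.deleteEdges {e}).IsCycle C} }
  | .frame =>
    { graph := Ω.graph.contractLoopFrame e x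
      balanced := {C | (C ∈ Ω.balanced ∧ ∀ f ∈ C, ¬ Ω.graph.Inc f x) ∨
        ∃ f, f ≠ e ∧ Ω.graph.IsLoopAt f x ∧ C = {f}} }

/-- `Ω.IsStep r Ω'`: `Ω'` arises from `Ω` by deleting or contracting one edge. -/
inductive IsStep (r : LoopRule) : MarkedGraph α β → MarkedGraph α β → Prop
  | delete {Ω : MarkedGraph α β} {e : β} (he : e ∈ E(Ω.graph)) : IsStep r Ω (Ω.delete e)
  | contractLink {Ω : MarkedGraph α β} {e : β} {x y : α} (he : Ω.graph.IsLink e x y)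
      (hxy : x ≠ y) : IsStep r Ω (Ω.contractLink e x y)
  | contractBalancedLoop {Ω : MarkedGraph α β} {e : β} {x : α} (he : Ω.graph.IsLoopAt e x)
      (hb : {e} ∈ Ω.balanced) : IsStep r Ω (Ω.delete e)
  | contractUnbalancedLoop {Ω : MarkedGraph α β} {e : β} {x : α} (he : Ω.graph.IsLoopAt e x)
      (hb : {e} ∉ Ω.balanced) : IsStep r Ω (Ω.contractLoop e x r)

/-- `Ω'` is a proper minor of `Ω`: it arises by a nonempty sequence of deletions and
contractions, unbalanced loops being contracted according to `r`. -/
def HasProperMinor (r : LoopRule) (Ω Ω' : MarkedGraph α β) : Prop :=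
  Relation.TransGen (IsStep r) Ω Ω'

end MarkedGraph

/-!
Split the vertices of the thick `t`-cycle so that it becomes a bipyramid over a `2k`-gon in which
every edge of the polygon is subdivided `t - 3` times. The bipyramid is a triangulated sphere, and
its `4k` faces are Hamiltonian cycles of the thick cycle. Declare all of them but one, the hole, to
be balanced, and no other cycle. Since the faces close up to a sphere, the values of the balanced
faces force the hole to have value `1` in every group labelling.

Switching a group labelling at the vertices of the bipyramid does not affect which of its closed
walks have value `1`, but it does affect the cycles of the thick cycle that jump between vertices of
the bipyramid, and over an infinite group a generic switching makes all of these unbalanced. Hence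
any set of faces that is realized on the bipyramid alone is realized on the thick cycle. This
applies to the set of all faces, and also to the set of all faces but the hole and a second face not
sharing its base edge: take labels supported on an arc of the polygon between the two base edges.
Deleting an edge destroys the hole or some other face, and contracting an edge retains only the
faces through it, so in either case the hole can be filled or accompanied by a second hole without
notice, and labellability passes on to further minors.
-/

namespace BiasedGraph

open Graph

variable {α β : Type*}

@[simp]
lemma stepEdges_nil : stepEdges ([] : List (β × α)) = ∅ := by
  ext; simp [stepEdges]

@[simp]
lemma stepEdges_cons (s : β × α) (L : List (β × α)) :
    stepEdges (s :: L) = insert s.1 (stepEdges L) := by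
  ext; simp [stepEdges]

@[simp]
lemma stepEdges_append (L M : List (β × α)) :
    stepEdges (L ++ M) = stepEdges L ∪ stepEdges M := by
  ext; simp [stepEdges]

lemma stepEdges_congr {L M : List (β × α)} (h : L.map Prod.fst = M.map Prod.fst) :
    stepEdges L = stepEdges M := by
  simp only [stepEdges, h]

/-- The set of ends of the edges in `C`: the vertex set of the subgraph with edge set `C`. -/
def endSet (G : Graph α β) (C : Set β) : Set α := {z | ∃ e ∈ C, G.Inc e z}

end BiasedGraph

section

open Graph BiasedGraph

variable {α β : Type*} {G H : Graph α β} {x y z : α} {L M : List (β × α)} {e : β} {C : Set β}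

lemma Graph.IsWalk.append (hL : G.IsWalk x L y) (hM : G.IsWalk y M z) : G.IsWalk x (L ++ M) z := by
  induction L generalizing x with
  | nil => obtain ⟨-, rfl⟩ := hL; exact hM
  | cons s L ih => exact ⟨hL.1, ih hL.2⟩

lemma Graph.IsWalk.left_mem (h : G.IsWalk x L y) : x ∈ V(G) := by
  cases L with
  | nil => exact h.1
  | cons s L => exact h.1.left_mem

lemma Graph.IsWalk.exists_of_append (h : G.IsWalk x (L ++ M) z) :
    ∃ y, G.IsWalk x L y ∧ G.IsWalk y M z := by
  induction L generalizing x with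
  | nil => exact ⟨x, ⟨IsWalk.left_mem h, rfl⟩, h⟩
  | cons s L ih =>
    obtain ⟨y, hL, hM⟩ := ih h.2
    exact ⟨y, ⟨h.1, hL⟩, hM⟩

lemma Graph.IsWalk.right_mem_vertices (h : G.IsWalk x L y) (hL : L ≠ []) : y ∈ L.map Prod.snd := by
  induction L generalizing x with
  | nil => exact absurd rfl hL
  | cons s L ih =>
    by_cases hL' : L = []
    · subst hL'
      simpa using h.2.2.symm
    · exact List.mem_cons_of_mem _ (ih h.2 hL')

lemma Graph.IsWalk.mono (h : G.IsWalk x L y) (hx : x ∈ V(G) → x ∈ V(H))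
    (hGH : ∀ e ∈ stepEdges L, ∀ a ∈ x :: L.map Prod.snd, ∀ b ∈ x :: L.map Prod.snd,
      G.IsLink e a b → H.IsLink e a b) :
    H.IsWalk x L y := by
  induction L generalizing x with
  | nil => exact ⟨hx h.1, h.2⟩
  | cons s L ih =>
    have hl : H.IsLink s.1 x s.2 := hGH s.1 (by simp) x (by simp) s.2 (by simp) h.1
    exact ⟨hl, ih h.2 (fun _ ↦ hl.right_mem) fun e he a ha b hb ↦
      hGH e (by simp [he]) a (List.mem_cons_of_mem _ ha) b (List.mem_cons_of_mem _ hb)⟩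

lemma Graph.IsWalk.mem_endSet (h : G.IsWalk x L y) (hz : z ∈ L.map Prod.snd) :
    z ∈ endSet G (stepEdges L) := by
  induction L generalizing x with
  | nil => simp at hz
  | cons s L ih =>
    rcases List.mem_cons.1 hz with rfl | hz
    · exact ⟨s.1, by simp, h.1.inc_right⟩
    · obtain ⟨e, he, hi⟩ := ih h.2 hz
      exact ⟨e, by simp [he], hi⟩

lemma Graph.IsWalk.mem_of_mem_endSet (h : G.IsWalk x L y) (hz : z ∈ endSet G (stepEdges L)) :
    z ∈ x :: L.map Prod.snd := by
  obtain ⟨e, he, hz⟩ := hz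
  induction L generalizing x with
  | nil => simp at he
  | cons s L ih =>
    rw [stepEdges_cons] at he
    rcases he with rfl | he
    · rcases hz.eq_or_eq_of_isLink h.1 with rfl | rfl <;> simp
    · exact List.mem_cons_of_mem _ (ih h.2 he)

lemma Graph.IsWalk.stepEdges_subset (h : G.IsWalk x L y) : stepEdges L ⊆ E(G) := by
  induction L generalizing x with
  | nil => simp
  | cons s L ih =>
    rw [stepEdges_cons]
    exact Set.insert_subset h.1.edge_mem (ih h.2)

lemma Graph.IsPath.eq_nil (h : G.IsPath x L x) : L = [] := by
  by_contra hL
  exact (List.nodup_cons.1 h.vertices_nodup).1 (h.isWalk.right_mem_vertices hL)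

lemma Graph.IsPath.tail {s : β × α} (h : G.IsPath x (s :: L) y) : G.IsPath s.2 L y :=
  ⟨h.isWalk.2, (List.nodup_cons.1 h.vertices_nodup).2⟩

lemma Graph.IsPath.notMem_tail_endSet {s : β × α} (h : G.IsPath x (s :: L) y) :
    x ∉ endSet G (stepEdges L) :=
  fun hx ↦ (List.nodup_cons.1 h.vertices_nodup).1 (h.tail.isWalk.mem_of_mem_endSet hx)

lemma Graph.IsSimpleClosedWalk.mem_vertices_iff (h : G.IsSimpleClosedWalk x L) :
    z ∈ L.map Prod.snd ↔ z ∈ endSet G (stepEdges L) := by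
  refine ⟨h.isWalk.mem_endSet, fun hz ↦ ?_⟩
  rcases List.mem_cons.1 (h.isWalk.mem_of_mem_endSet hz) with rfl | hz
  · exact h.isWalk.right_mem_vertices h.ne_nil
  · exact hz

lemma Graph.IsSimpleClosedWalk.tail_isPath {s : β × α} (h : G.IsSimpleClosedWalk x (s :: L)) :
    G.IsPath s.2 L x :=
  ⟨h.isWalk.2, h.vertices_nodup⟩

lemma Graph.IsSimpleClosedWalk.exists_rotate (h : G.IsSimpleClosedWalk x L)
    (hz : z ∈ endSet G (stepEdges L)) :
    ∃ M, G.IsSimpleClosedWalk z M ∧ stepEdges M = stepEdges L := by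
  obtain ⟨⟨e, z⟩, hs, rfl⟩ := List.mem_map.1 (h.mem_vertices_iff.2 hz)
  obtain ⟨L₁, L₂, rfl⟩ := List.append_of_mem hs
  rw [List.append_cons] at h ⊢
  have hperm : (L₂ ++ (L₁ ++ [(e, z)])).Perm (L₁ ++ [(e, z)] ++ L₂) := List.perm_append_comm
  refine ⟨L₂ ++ (L₁ ++ [(e, z)]), ⟨?_, by simp, ?_, ?_⟩, ?_⟩
  · obtain ⟨y, h₁, h₂⟩ := h.isWalk.exists_of_append
    obtain ⟨w, -, hstep⟩ := h₁.exists_of_append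
    obtain rfl : z = y := hstep.2.2
    exact h₂.append h₁
  · exact (hperm.map _).nodup_iff.2 h.edges_nodup
  · exact (hperm.map _).nodup_iff.2 h.vertices_nodup
  · rw [stepEdges_append, stepEdges_append _ L₂, Set.union_comm]

lemma Graph.IsCycle.finite (h : G.IsCycle C) : C.Finite := by
  obtain ⟨x, L, -, rfl⟩ := h
  exact List.finite_toSet _

lemma Graph.IsCycle.nonempty (h : G.IsCycle C) : C.Nonempty := by
  obtain ⟨x, L, h, rfl⟩ := h
  obtain ⟨s, hs⟩ := List.exists_mem_of_ne_nil L h.ne_nil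
  exact ⟨s.1, List.mem_map_of_mem hs⟩

lemma Graph.IsCycle.subset_edgeSet (h : G.IsCycle C) : C ⊆ E(G) := by
  obtain ⟨x, L, h, rfl⟩ := h
  exact h.isWalk.stepEdges_subset

lemma Graph.IsCycle.ncard_endSet (h : G.IsCycle C) : (endSet G C).ncard = C.ncard := by
  classical
  obtain ⟨x, L, h, rfl⟩ := h
  have hvert : endSet G (stepEdges L) = (L.map Prod.snd).toFinset := by
    ext z
    rw [List.coe_toFinset]
    exact h.mem_vertices_iff.symm
  have hedge : stepEdges L = (L.map Prod.fst).toFinset := (List.coe_toFinset _).symm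
  rw [hvert, hedge, Set.ncard_coe_finset, Set.ncard_coe_finset,
    List.toFinset_card_of_nodup h.vertices_nodup, List.toFinset_card_of_nodup h.edges_nodup,
    List.length_map, List.length_map]

lemma Graph.IsCycle.finite_endSet (h : G.IsCycle C) : (endSet G C).Finite := by
  refine Set.finite_of_ncard_pos ?_
  rw [h.ncard_endSet]
  exact (Set.ncard_pos h.finite).2 h.nonempty

lemma Graph.IsCycle.mono (h : G.IsCycle C) (hV : V(G) ⊆ V(H))
    (hGH : ∀ e ∈ C, ∀ a b, G.IsLink e a b → H.IsLink e a b) : H.IsCycle C := by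
  obtain ⟨x, L, h, rfl⟩ := h
  exact ⟨x, L, ⟨h.isWalk.mono (fun hx ↦ hV hx) fun e he a _ b _ ↦ hGH e he a b, h.ne_nil,
    h.edges_nodup, h.vertices_nodup⟩, rfl⟩

lemma Graph.IsCycle.of_isLoopAt (h : G.IsLoopAt e x) : G.IsCycle {e} :=
  ⟨x, [(e, x)], ⟨⟨h, h.vertex_mem, rfl⟩, by simp, by simp, by simp⟩, by simp⟩

lemma Graph.IsCycle.eq_singleton (h : G.IsCycle C) (he : e ∈ C) (hl : G.IsLoopAt e x) :
    C = {e} := by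
  obtain ⟨w, L, h, rfl⟩ := h
  obtain ⟨M, h, hM⟩ := h.exists_rotate ⟨e, he, hl.inc⟩
  rw [← hM] at he ⊢
  obtain ⟨⟨e, z⟩, hs, rfl⟩ := List.mem_map.1 he
  obtain ⟨L₁, L₂, rfl⟩ := List.append_of_mem hs
  obtain ⟨y, h₁, h₂⟩ := h.isWalk.exists_of_append
  obtain rfl := hl.eq_of_inc h₂.1.inc_left
  obtain rfl := hl.eq_of_inc h₂.1.inc_right
  have hnodup := h.vertices_nodup
  simp only [List.map_append, List.map_cons, List.nodup_append, List.nodup_cons] at hnodup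
  have hL₁ : L₁ = [] := by
    by_contra hL
    exact hnodup.2.2 _ (h₁.right_mem_vertices hL) _ (by simp) rfl
  have hL₂ : L₂ = [] := by
    by_contra hL
    exact hnodup.2.1.1 (h₂.2.right_mem_vertices hL)
  simp [hL₁, hL₂]

end

namespace BiasedGraph

open Graph

variable {α β : Type*} {G : Graph α β} {e : β} {C : Set β}

lemma isCycle_deleteEdges : (G.deleteEdges {e}).IsCycle C ↔ G.IsCycle C ∧ e ∉ C := by
  refine ⟨fun h ↦ ⟨h.mono (by simp) fun f _ a b hf ↦ ?_, fun he ↦ ?_⟩, fun ⟨h, he⟩ ↦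
    h.mono (by simp) fun f hf a b hl ↦ ?_⟩
  · exact deleteEdges_le.isLink_mono hf
  · simpa using h.subset_edgeSet he
  · simp only [deleteEdges_isLink, Set.mem_singleton_iff]
    exact ⟨hl, fun h ↦ he (h ▸ hf)⟩

end BiasedGraph

/-! ### Potentials -/

namespace Graph.GroupLabelling

open BiasedGraph

variable {α β Γ : Type*} [Group Γ] {G : Graph α β} {φ : G.GroupLabelling Γ} {p q : α → Γ}
  {x y : α} {e : β} {C D : Set β} {L : List (β × α)}

open Classical in
/-- The factor that an edge contributes to the value of a walk leaving `x` along it. -/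
noncomputable def stepValue (φ : G.GroupLabelling Γ) (e : β) (x : α) : Γ :=
  if φ.tail e = x then φ.label e else (φ.label e)⁻¹

/-- A potential for `φ` on the edge set `C`: a vertex function whose increments along the edges
of `C` are their labels. It is constrained only at the ends of the edges of `C`. -/
def IsPotential (φ : G.GroupLabelling Γ) (C : Set β) (p : α → Γ) : Prop :=
  ∀ e ∈ C, p (φ.tail e) * φ.label e = p (φ.head e)

lemma mul_stepValue_eq_iff (hl : G.IsLink e x y) :
    p x * φ.stepValue e x = p y ↔ p (φ.tail e) * φ.label e = p (φ.head e) := by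
  unfold stepValue
  rcases (φ.isLink e hl.edge_mem).eq_and_eq_or_eq_and_eq hl with ⟨ht, hh⟩ | ⟨ht, hh⟩
  · rw [if_pos ht, ht, hh]
  · rw [ht, hh]
    split_ifs with hyx
    · rw [hyx]
    · rw [mul_inv_eq_iff_eq_mul, eq_comm]

lemma IsPotential.mono (hp : φ.IsPotential D p) (h : C ⊆ D) : φ.IsPotential C p :=
  fun e he ↦ hp e (h he)

lemma IsPotential.congr (hp : φ.IsPotential C p) (hC : C ⊆ E(G))
    (hpq : ∀ z ∈ endSet G C, p z = q z) : φ.IsPotential C q := fun e he ↦ by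
  have hl := φ.isLink e (hC he)
  rw [← hpq _ ⟨e, he, hl.inc_left⟩, ← hpq _ ⟨e, he, hl.inc_right⟩]
  exact hp e he

lemma isPotential_insert : φ.IsPotential (insert e C) p ↔
    p (φ.tail e) * φ.label e = p (φ.head e) ∧ φ.IsPotential C p :=
  Set.forall_mem_insert

lemma IsPotential.mul_value (hp : φ.IsPotential (stepEdges L) p) (h : G.IsWalk x L y) :
    p x * φ.value x L = p y := by
  induction L generalizing x with
  | nil =>
    obtain ⟨-, rfl⟩ := h
    exact mul_one _
  | cons s L ih =>
    rw [stepEdges_cons, isPotential_insert] at hp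
    calc p x * φ.value x (s :: L) = p x * φ.stepValue s.1 x * φ.value s.2 L :=
          (mul_assoc _ _ _).symm
      _ = p s.2 * φ.value s.2 L := by rw [(mul_stepValue_eq_iff h.1).2 hp.1]
      _ = p y := ih hp.2 h.2

lemma IsPotential.exists_insert (hp : φ.IsPotential C p) (hC : C ⊆ E(G)) (hl : G.IsLink e x y)
    (hxy : x ≠ y) (hx : x ∉ endSet G C) : ∃ q, φ.IsPotential (insert e C) q := by
  classical
  refine ⟨Function.update p x (p y * (φ.stepValue e x)⁻¹), isPotential_insert.2 ⟨?_, ?_⟩⟩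
  · rw [← mul_stepValue_eq_iff hl, Function.update_self, Function.update_of_ne hxy.symm,
      inv_mul_cancel_right]
  · exact hp.congr hC fun z hz ↦ (Function.update_of_ne (ne_of_mem_of_not_mem hz hx) _ _).symm

lemma _root_.Graph.IsPath.exists_isPotential (φ : G.GroupLabelling Γ) (h : G.IsPath x L y) :
    ∃ p, φ.IsPotential (stepEdges L) p := by
  induction L generalizing x with
  | nil => exact ⟨1, by simp [IsPotential]⟩
  | cons s L ih =>
    obtain ⟨p, hp⟩ := ih h.tail
    have hne : x ≠ s.2 := fun hx ↦ (List.nodup_cons.1 h.vertices_nodup).1 (by simp [hx])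
    rw [stepEdges_cons]
    exact hp.exists_insert h.tail.isWalk.stepEdges_subset h.isWalk.1 hne h.notMem_tail_endSet

theorem mem_balancedCycles_iff :
    C ∈ φ.balancedCycles ↔ G.IsCycle C ∧ ∃ p, φ.IsPotential C p := by
  constructor
  · rintro ⟨x, _ | ⟨s, L⟩, h, rfl, hv⟩
    · exact absurd rfl h.ne_nil
    refine ⟨⟨x, s :: L, h, rfl⟩, ?_⟩
    obtain ⟨p, hp⟩ := h.tail_isPath.exists_isPotential φ
    have hstep : φ.value s.2 L * φ.stepValue s.1 x = 1 := mul_eq_one_comm.1 hv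
    refine ⟨p, ?_⟩
    rw [stepEdges_cons, isPotential_insert]
    refine ⟨(mul_stepValue_eq_iff h.isWalk.1).1 ?_, hp⟩
    rw [← hp.mul_value h.isWalk.2, mul_assoc, hstep, mul_one]
  · rintro ⟨⟨x, L, h, rfl⟩, p, hp⟩
    exact ⟨x, L, h, rfl, mul_eq_left.1 (hp.mul_value h.isWalk)⟩

end Graph.GroupLabelling

/-! ### Minors of labellable graphs -/

section

open Graph BiasedGraph

namespace BiasedGraph

variable {α β : Type*} {G : Graph α β} {x y z w a b : α} {e f : β} {C : Set β}

open Classical in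
/-- The vertex map of the contraction that identifies `y` with `x`. -/
noncomputable def mergeVertex (x y z : α) : α := if z = y then x else z

lemma mergeVertex_eq_left_iff : mergeVertex x y z = x ↔ z = x ∨ z = y := by
  unfold mergeVertex
  split_ifs with h <;> simp [h]

lemma eq_of_mergeVertex_eq (h : mergeVertex x y z = w) (hw : w ≠ x) : z = w := by
  unfold mergeVertex at h
  split_ifs at h with hz
  · exact absurd h.symm hw
  · exact h

lemma contractLink_isLink : (G.contractLink e x y).IsLink f a b ↔
    f ≠ e ∧ ∃ a' b', G.IsLink f a' b' ∧ mergeVertex x y a' = a ∧ mergeVertex x y b' = b := by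
  simp only [contractLink, map_isLink, Relation.Map, deleteEdges_isLink, Set.mem_singleton_iff]
  constructor
  · rintro ⟨a', b', ⟨h, hf⟩, ha, hb⟩
    exact ⟨hf, a', b', h, ha, hb⟩
  · rintro ⟨hf, a', b', h, ha, hb⟩
    exact ⟨a', b', ⟨h, hf⟩, ha, hb⟩

lemma mem_edgeSet_contractLink : f ∈ E(G.contractLink e x y) ↔ f ∈ E(G) ∧ f ≠ e := by
  simp [contractLink]

lemma endSet_contractLink (he : e ∉ C) :
    endSet (G.contractLink e x y) C = mergeVertex x y '' endSet G C := by
  ext z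
  constructor
  · rintro ⟨f, hf, w, hl⟩
    obtain ⟨-, a, b, hab, rfl, -⟩ := contractLink_isLink.1 hl
    exact ⟨a, ⟨f, hf, hab.inc_left⟩, rfl⟩
  · rintro ⟨a, ⟨f, hf, b, hab⟩, rfl⟩
    exact ⟨f, hf, _, contractLink_isLink.2 ⟨fun h ↦ he (h ▸ hf), a, b, hab, rfl, rfl⟩⟩

lemma notMem_of_isCycle_contractLink (h : (G.contractLink e x y).IsCycle C) : e ∉ C :=
  fun he ↦ (mem_edgeSet_contractLink.1 (h.subset_edgeSet he)).2 rfl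

lemma notMem_endSet_of_isCycle_contractLink (h : (G.contractLink e x y).IsCycle C)
    (hC : G.IsCycle C) (hxy : x ≠ y) : x ∉ endSet G C ∨ y ∉ endSet G C := by
  by_contra! hends
  have hcard : (mergeVertex x y '' endSet G C).ncard = (endSet G C).ncard := by
    rw [← endSet_contractLink (notMem_of_isCycle_contractLink h), h.ncard_endSet, hC.ncard_endSet]
  have hinj := (Set.ncard_image_iff hC.finite_endSet).1 hcard
  exact hxy (hinj hends.1 hends.2 (by simp [mergeVertex]))

lemma isLink_of_mergeVertex_eq (he : G.IsLink e x y) (ha : mergeVertex x y a = x)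
    (hb : mergeVertex x y b = x) (hab : a ≠ b) : G.IsLink e a b := by
  rw [mergeVertex_eq_left_iff] at ha hb
  rcases ha with rfl | rfl <;> rcases hb with rfl | rfl
  · exact absurd rfl hab
  · exact he
  · exact he.symm
  · exact absurd rfl hab

end BiasedGraph

variable {α β : Type*} {G : Graph α β} {x y z c : α} {e : β} {C : Set β} {L : List (β × α)}

-- A path into the new vertex `x` lifts up to its first vertex that merges into `x`, which need
-- not be `x` itself: it is one of the two ends of the contracted edge.
lemma Graph.IsPath.exists_lift (h : (G.contractLink e x y).IsPath z L x) (hc : c ∈ V(G))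
    (hcz : mergeVertex x y c = z) :
    ∃ b M, mergeVertex x y b = x ∧ G.IsPath c M b ∧ M.map Prod.fst = L.map Prod.fst ∧
      (M.map Prod.snd).map (mergeVertex x y) = L.map Prod.snd ∧
      ∀ w ∈ c :: M.map Prod.snd, mergeVertex x y w = x → w = b := by
  induction L generalizing z c with
  | nil =>
    obtain ⟨-, rfl⟩ := h.isWalk
    exact ⟨c, [], hcz, ⟨⟨hc, rfl⟩, by simp⟩, rfl, rfl, by simp⟩
  | cons s L ih =>
    have hzx : z ≠ x := by
      rintro rfl
      exact List.cons_ne_nil _ _ h.eq_nil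
    obtain ⟨-, a, d, had, ha, hd⟩ := contractLink_isLink.1 h.isWalk.1
    obtain rfl : c = a := (eq_of_mergeVertex_eq hcz hzx).trans (eq_of_mergeVertex_eq ha hzx).symm
    obtain ⟨b, M, hb, hM, hMf, hMs, hMb⟩ := ih h.tail had.right_mem hd
    refine ⟨b, (s.1, d) :: M, hb, ⟨⟨had, hM.isWalk⟩, ?_⟩, by simp [hMf], by simp [hMs, hd], ?_⟩
    · refine List.nodup_cons.2 ⟨fun hmem ↦ (List.nodup_cons.1 h.vertices_nodup).1 ?_,
        hM.vertices_nodup⟩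
      have := List.mem_map_of_mem (f := mergeVertex x y) hmem
      rwa [List.map_cons, List.map_cons, hMs, hd, hcz] at this
    · intro w hw hwx
      rcases List.mem_cons.1 hw with rfl | hw
      · exact absurd (hcz.symm.trans hwx) hzx
      · exact hMb w hw hwx

lemma Graph.IsCycle.of_contractLink_of_notMem (h : (G.contractLink e x y).IsCycle C)
    (hx : x ∉ endSet (G.contractLink e x y) C) : G.IsCycle C := by
  obtain ⟨w, L, h, rfl⟩ := h
  have hne : ∀ v ∈ w :: L.map Prod.snd, v ≠ x := by
    intro v hv
    refine ne_of_mem_of_not_mem (h.mem_vertices_iff.1 ?_) hx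
    rcases List.mem_cons.1 hv with rfl | hv
    · exact h.isWalk.right_mem_vertices h.ne_nil
    · exact hv
  refine ⟨w, L, ⟨h.isWalk.mono ?_ ?_, h.ne_nil, h.edges_nodup, h.vertices_nodup⟩, rfl⟩
  · rintro ⟨w', hw', hm⟩
    rwa [← eq_of_mergeVertex_eq hm (hne w (by simp))]
  · intro f _ a ha b hb hl
    obtain ⟨-, a', b', hab, ha', hb'⟩ := contractLink_isLink.1 hl
    rwa [← eq_of_mergeVertex_eq ha' (hne a ha), ← eq_of_mergeVertex_eq hb' (hne b hb)]

lemma Graph.IsSimpleClosedWalk.of_contractLink (h : (G.contractLink e x y).IsSimpleClosedWalk x L)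
    (he : G.IsLink e x y) : G.IsCycle (stepEdges L) ∨ G.IsCycle (insert e (stepEdges L)) := by
  obtain _ | ⟨⟨f, z⟩, L⟩ := L
  · exact absurd rfl h.ne_nil
  have heL : e ∉ stepEdges ((f, z) :: L) := notMem_of_isCycle_contractLink ⟨x, _, h, rfl⟩
  obtain ⟨-, a, c, hac, ha, hc⟩ := contractLink_isLink.1 h.isWalk.1
  obtain ⟨b, M, hb, hM, hMf, -, hMb⟩ := h.tail_isPath.exists_lift hac.right_mem hc
  have hedges : ((f, c) :: M).map Prod.fst = ((f, z) :: L).map Prod.fst := by simp [hMf]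
  have hnodup := h.edges_nodup
  rw [← stepEdges_congr hedges] at heL ⊢
  rw [← hedges] at hnodup
  by_cases hab : a = b
  · subst hab
    exact Or.inl ⟨a, (f, c) :: M, ⟨⟨hac, hM.isWalk⟩, by simp, hnodup, hM.vertices_nodup⟩, rfl⟩
  · refine Or.inr ⟨b, (e, a) :: (f, c) :: M, ⟨⟨?_, hac, hM.isWalk⟩, by simp, ?_, ?_⟩,
      stepEdges_cons _ _⟩
    · exact isLink_of_mergeVertex_eq he hb ha (Ne.symm hab)
    · exact List.nodup_cons.2 ⟨heL, hnodup⟩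
    · exact List.nodup_cons.2 ⟨fun hmem ↦ hab (hMb a hmem ha), hM.vertices_nodup⟩

lemma Graph.IsCycle.of_contractLink (h : (G.contractLink e x y).IsCycle C)
    (he : G.IsLink e x y) : G.IsCycle C ∨ G.IsCycle (insert e C) := by
  by_cases hx : x ∈ endSet (G.contractLink e x y) C
  · obtain ⟨w, L, hL, rfl⟩ := h
    obtain ⟨M, hM, hML⟩ := hL.exists_rotate hx
    rw [← hML]
    exact hM.of_contractLink he
  · exact Or.inl (h.of_contractLink_of_notMem hx)

end

namespace Graph.GroupLabelling

open BiasedGraph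

variable {α β Γ : Type*} {G H : Graph α β} {x y : α} {e f : β} {C : Set β}

/-- The restriction of a labelling to a subgraph. -/
def restrict (φ : G.GroupLabelling Γ) (h : H ≤ G) : H.GroupLabelling Γ where
  tail := φ.tail
  head := φ.head
  isLink f hf := (h.isLink_iff hf).2 (φ.isLink f (h.edgeSet_mono hf))
  label := φ.label

variable [Group Γ] {φ : G.GroupLabelling Γ} {p s : α → Γ} {g : Γ}

/-- The labelling of a contraction obtained by switching with `s`. Switching preserves the
existence of potentials, and the balanced cycles are those of the contraction when `s` is a
potential on the contracted edge, so that its switched label is trivial. -/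
noncomputable def contractLink (φ : G.GroupLabelling Γ) (s : α → Γ) (e : β) (x y : α) :
    (G.contractLink e x y).GroupLabelling Γ where
  tail f := mergeVertex x y (φ.tail f)
  head f := mergeVertex x y (φ.head f)
  isLink f hf := by
    obtain ⟨hf, hfe⟩ := mem_edgeSet_contractLink.1 hf
    exact contractLink_isLink.2 ⟨hfe, _, _, φ.isLink f hf, rfl, rfl⟩
  label f := s (φ.tail f) * φ.label f * (s (φ.head f))⁻¹

lemma isPotential_contractLink_iff : (φ.contractLink s e x y).IsPotential C p ↔
    φ.IsPotential C (fun v ↦ p (mergeVertex x y v) * s v) :=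
  forall₂_congr fun f _ ↦ by
    simp only [contractLink, ← mul_assoc, mul_inv_eq_iff_eq_mul]

lemma exists_isPotential_contractLink_iff (hl : G.IsLink e x y) (hs : φ.IsPotential {e} s) :
    (∃ p, (φ.contractLink s e x y).IsPotential C p) ↔ ∃ p, φ.IsPotential (insert e C) p := by
  have hse : s x * φ.stepValue e x = s y := (mul_stepValue_eq_iff hl).2 (hs e rfl)
  simp only [isPotential_contractLink_iff, isPotential_insert, ← mul_stepValue_eq_iff hl]
  constructor
  · rintro ⟨p, hp⟩
    refine ⟨_, ?_, hp⟩
    simp only [mergeVertex, if_true, ite_self, mul_assoc, hse]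
  · rintro ⟨p, hpe, hp⟩
    have hxy : p y * (s y)⁻¹ = p x * (s x)⁻¹ := by
      rw [← hse, ← hpe, mul_inv_rev, mul_assoc, mul_inv_cancel_left]
    refine ⟨fun v ↦ p v * (s v)⁻¹, ?_⟩
    convert hp using 2 with v
    dsimp only [mergeVertex]
    split_ifs with hv
    · rw [← hxy, hv, inv_mul_cancel_right]
    · rw [inv_mul_cancel_right]

open Classical in
/-- The labelling of a frame contraction at `x`: the edges leaving `x` become loops with label
`g`, which are unbalanced if `g ≠ 1`, and the loops at `x` get the trivial label. -/
noncomputable def contractLoopFrame (φ : G.GroupLabelling Γ) (g : Γ) (e : β) (x : α) :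
    (G.contractLoopFrame e x).GroupLabelling Γ where
  tail f := if φ.tail f = x then φ.head f else φ.tail f
  head f := if φ.head f = x then φ.tail f else φ.head f
  isLink f hf := by
    obtain ⟨a, b, hfe, hab⟩ := (Graph.edge_mem_iff_exists_isLink _ _).1 hf
    have hl := φ.isLink f (by rcases hab with ⟨h, -⟩ | ⟨h, -⟩ | ⟨h, -⟩ <;> exact h.edge_mem)
    refine ⟨hfe, ?_⟩
    by_cases ht : φ.tail f = x <;> by_cases hh : φ.head f = x
    · rw [ht, hh] at hl
      simpa [ht, hh] using hl
    · rw [ht] at hl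
      simpa [ht, hh] using Or.inr hl
    · rw [hh] at hl
      simpa [ht, hh] using Or.inr hl.symm
    · simpa [ht, hh] using Or.inl hl
  label f := if G.IsLoopAt f x then 1 else if G.Inc f x then g else φ.label f

lemma isPotential_contractLoopFrame_iff (hC : C ⊆ E(G)) (hx : ∀ f ∈ C, ¬ G.Inc f x) :
    (φ.contractLoopFrame g e x).IsPotential C p ↔ φ.IsPotential C p :=
  forall₂_congr fun f hf ↦ by
    have hl := φ.isLink f (hC hf)
    have ht : φ.tail f ≠ x := fun h ↦ hx f hf (h ▸ hl.inc_left)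
    have hh : φ.head f ≠ x := fun h ↦ hx f hf (h ▸ hl.inc_right)
    have hloop : ¬ G.IsLoopAt f x := fun h ↦ hx f hf h.inc
    simp only [contractLoopFrame, ht, hh, hloop, hx f hf, if_false]

lemma IsPotential.isLoopAt_of_inc (hp : (φ.contractLoopFrame g e x).IsPotential C p)
    (hg : g ≠ 1) (hf : f ∈ C) (hx : G.Inc f x) : G.IsLoopAt f x := by
  obtain ⟨w, hw⟩ := hx
  by_contra hloop
  have hwx : w ≠ x := by
    rintro rfl
    exact hloop hw
  have hpf := hp f hf
  rcases (φ.isLink f hw.edge_mem).eq_and_eq_or_eq_and_eq hw with ⟨ht, hh⟩ | ⟨ht, hh⟩ <;>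
    simp [contractLoopFrame, ht, hh, hwx, hloop, hw.inc_left, hg] at hpf

end Graph.GroupLabelling

namespace BiasedGraph

open Graph

variable {α β : Type*} {G : Graph α β} {x : α} {e f : β} {C : Set β}

lemma isLoopAt_contractLoopFrame (hfe : f ≠ e) (hf : G.IsLoopAt f x) :
    (G.contractLoopFrame e x).IsLoopAt f x :=
  ⟨hfe, Or.inr (Or.inl ⟨hf, rfl, rfl⟩)⟩

lemma isCycle_contractLoopFrame_iff (he : G.IsLoopAt e x) (hx : ∀ f ∈ C, ¬ G.Inc f x) :
    (G.contractLoopFrame e x).IsCycle C ↔ G.IsCycle C := by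
  refine ⟨fun h ↦ h.mono subset_rfl fun f hf a b hab ↦ ?_,
    fun h ↦ h.mono subset_rfl fun f hf a b hab ↦ ⟨?_, Or.inl ⟨hab, ?_, ?_⟩⟩⟩
  · rcases hab with ⟨-, ⟨h, -⟩ | ⟨h, -⟩ | ⟨h, -⟩⟩
    · exact h
    · exact absurd h.inc (hx f hf)
    · exact absurd h.inc_left (hx f hf)
  · rintro rfl
    exact hx f hf he.inc
  · rintro rfl
    exact hx f hf hab.inc_left
  · rintro rfl
    exact hx f hf hab.inc_right

end BiasedGraph

namespace MarkedGraph

open Graph BiasedGraph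

variable {α β Γ : Type*} [Group Γ] {Ω Ω' : MarkedGraph α β} {x y : α} {e : β} {r : LoopRule}

lemma Labellable.delete (h : Ω.Labellable Γ) (e : β) : (Ω.delete e).Labellable Γ := by
  obtain ⟨φ, hφ⟩ := h
  refine ⟨φ.restrict deleteEdges_le, ?_⟩
  ext C
  refine GroupLabelling.mem_balancedCycles_iff.trans ?_
  change _ ↔ C ∈ Ω.balanced ∧ e ∉ C
  rw [← hφ, GroupLabelling.mem_balancedCycles_iff]
  exact (and_congr_left fun _ ↦ isCycle_deleteEdges).trans and_right_comm

lemma Labellable.contractLink (h : Ω.Labellable Γ) (he : Ω.graph.IsLink e x y) (hxy : x ≠ y) :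
    (Ω.contractLink e x y).Labellable Γ := by
  obtain ⟨φ, hφ⟩ := h
  obtain ⟨s, hs⟩ : ∃ s, φ.IsPotential {e} s := by
    have hempty : φ.IsPotential ∅ 1 := by simp [GroupLabelling.IsPotential]
    simpa using hempty.exists_insert (Set.empty_subset _) he hxy (by simp [endSet])
  refine ⟨φ.contractLink s e x y, ?_⟩
  ext C
  refine GroupLabelling.mem_balancedCycles_iff.trans (and_congr_right
    fun (hC : (Ω.graph.contractLink e x y).IsCycle C) ↦
      (GroupLabelling.exists_isPotential_contractLink_iff he hs).trans ?_)
  rw [Set.union_singleton, ← hφ, GroupLabelling.mem_balancedCycles_iff,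
    GroupLabelling.mem_balancedCycles_iff]
  constructor
  · rintro ⟨p, hp⟩
    exact (hC.of_contractLink he).imp (⟨·, p, hp.mono (Set.subset_insert _ _)⟩) (⟨·, p, hp⟩)
  · rintro (⟨hCG, p, hp⟩ | ⟨-, hp⟩)
    · rcases notMem_endSet_of_isCycle_contractLink hC hCG hxy with hx | hy
      · exact hp.exists_insert hCG.subset_edgeSet he hxy hx
      · exact hp.exists_insert hCG.subset_edgeSet he.symm hxy.symm hy
    · exact hp

lemma Labellable.contractLoop_lift (h : Ω.Labellable Γ) (e : β) (x : α) :
    (Ω.contractLoop e x .lift).Labellable Γ := by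
  obtain ⟨φ, -⟩ := h
  refine ⟨{ φ.restrict deleteEdges_le with label := 1 }, ?_⟩
  ext C
  refine GroupLabelling.mem_balancedCycles_iff.trans ?_
  exact and_iff_left ⟨1, fun f _ ↦ one_mul _⟩

lemma Labellable.contractLoop_frame [Nontrivial Γ] (h : Ω.Labellable Γ)
    (he : Ω.graph.IsLoopAt e x) : (Ω.contractLoop e x .frame).Labellable Γ := by
  obtain ⟨φ, hφ⟩ := h
  obtain ⟨g, hg⟩ := exists_ne (1 : Γ)
  refine ⟨φ.contractLoopFrame g e x, ?_⟩
  ext C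
  refine GroupLabelling.mem_balancedCycles_iff.trans ?_
  change _ ↔ (C ∈ Ω.balanced ∧ ∀ f ∈ C, ¬ Ω.graph.Inc f x) ∨
    ∃ f, f ≠ e ∧ Ω.graph.IsLoopAt f x ∧ C = {f}
  rw [← hφ, GroupLabelling.mem_balancedCycles_iff]
  constructor
  · rintro ⟨hC, p, hp⟩
    by_cases hx : ∀ f ∈ C, ¬ Ω.graph.Inc f x
    · have hCG := (isCycle_contractLoopFrame_iff he hx).1 hC
      have hpG := (GroupLabelling.isPotential_contractLoopFrame_iff hCG.subset_edgeSet hx).1 hp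
      exact Or.inl ⟨⟨hCG, p, hpG⟩, hx⟩
    · push Not at hx
      obtain ⟨f, hf, hfx⟩ := hx
      have hloop := hp.isLoopAt_of_inc hg hf hfx
      obtain ⟨-, -, hfe, -⟩ := (Graph.edge_mem_iff_exists_isLink _ _).1 (hC.subset_edgeSet hf)
      exact Or.inr ⟨f, hfe, hloop, hC.eq_singleton hf (isLoopAt_contractLoopFrame hfe hloop)⟩
  · rintro (⟨⟨hC, p, hp⟩, hx⟩ | ⟨f, hfe, hf, rfl⟩)
    · exact ⟨(isCycle_contractLoopFrame_iff he hx).2 hC, p,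
        (GroupLabelling.isPotential_contractLoopFrame_iff hC.subset_edgeSet hx).2 hp⟩
    · refine ⟨IsCycle.of_isLoopAt (isLoopAt_contractLoopFrame hfe hf), 1, ?_⟩
      rintro _ rfl
      simp [GroupLabelling.contractLoopFrame, hf]

lemma Labellable.isStep [Nontrivial Γ] (h : Ω.Labellable Γ) (hs : IsStep r Ω Ω') :
    Ω'.Labellable Γ := by
  cases hs with
  | delete => exact h.delete _
  | contractLink he hxy => exact h.contractLink he hxy
  | contractBalancedLoop => exact h.delete _
  | contractUnbalancedLoop he =>
    cases r with
    | lift => exact h.contractLoop_lift _ _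
    | frame => exact h.contractLoop_frame he

lemma HasProperMinor.labellable [Nontrivial Γ] (h : HasProperMinor r Ω Ω')
    (hs : ∀ Ω₁, IsStep r Ω Ω₁ → Ω₁.Labellable Γ) : Ω'.Labellable Γ := by
  induction h with
  | single h => exact hs _ h
  | tail _ h ih => exact ih.isStep h

end MarkedGraph

/-! ### Generic assignments -/

namespace BiasedGraph

lemma card_mul_card_subtype_le {ι A : Type*} [Fintype ι] [DecidableEq ι] [Fintype A]
    {P : (ι → A) → Prop} [DecidablePred P] {i : ι}
    (hP : ∀ x a, P x → P (Function.update x i a) → a = x i) :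
    Fintype.card A * Fintype.card {x // P x} ≤ Fintype.card (ι → A) := by
  let F : A × {x // P x} → ι → A := fun ax ↦ Function.update ax.2.1 i ax.1
  rw [← Fintype.card_prod]
  refine Fintype.card_le_of_injective F ?_
  rintro ⟨a, x, hx⟩ ⟨b, y, hy⟩ hxy
  have hab : a = b := by simpa [F] using congrFun hxy i
  have hupdate : Function.update x i (y i) = y := by
    simpa [F] using congrArg (Function.update · i (y i)) hxy
  have hyx : y i = x i := hP x _ hx (by rwa [hupdate])
  have : x = y := by rw [← hupdate, hyx, Function.update_eq_self]
  simp only [hab, this]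

lemma exists_forall_not_of_update {ι σ Γ : Type*} [Finite ι] [Finite σ] [Infinite Γ]
    [DecidableEq ι] (P : σ → (ι → Γ) → Prop)
    (hP : ∀ s, ∃ i, ∀ x g, P s x → P s (Function.update x i g) → g = x i) :
    ∃ x, ∀ s, ¬ P s x := by
  -- On the assignments with values in a finite set `A`, each `P s` holds with density at most
  -- `1 / |A|`, so for `|A| > |σ|` the sets cannot cover.
  classical
  have := Fintype.ofFinite ι
  have := Fintype.ofFinite σ
  by_contra! hbad
  obtain ⟨A, hA⟩ := Infinite.exists_subset_card_eq Γ (Fintype.card σ + 1)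
  let Q : σ → (ι → A) → Prop := fun s x ↦ P s (Subtype.val ∘ x)
  choose s hs using fun x : ι → A ↦ hbad (Subtype.val ∘ x)
  have hcover : Fintype.card (ι → A) ≤ ∑ s, Fintype.card {x // Q s x} := by
    rw [← Fintype.card_sigma]
    refine Fintype.card_le_of_injective (fun x ↦ ⟨s x, x, hs x⟩) fun x y hxy ↦ ?_
    exact congrArg (fun z : Σ s, {x // Q s x} ↦ z.2.1) hxy
  have hfew : ∀ s, Fintype.card A * Fintype.card {x // Q s x} ≤ Fintype.card (ι → A) := by
    intro s
    obtain ⟨i, hi⟩ := hP s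
    refine card_mul_card_subtype_le (i := i) fun x a hx hxa ↦ Subtype.ext (hi _ _ hx ?_)
    rwa [← Function.comp_update]
  have hcount : Fintype.card A * Fintype.card (ι → A) ≤
      Fintype.card σ * Fintype.card (ι → A) :=
    calc Fintype.card A * Fintype.card (ι → A)
        ≤ ∑ s, Fintype.card A * Fintype.card {x // Q s x} := by
          rw [← Finset.mul_sum]
          exact Nat.mul_le_mul_left _ hcover
      _ ≤ ∑ _s : σ, Fintype.card (ι → A) := Finset.sum_le_sum fun s _ ↦ hfew s
      _ = Fintype.card σ * Fintype.card (ι → A) := by simp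
  have hA' : Fintype.card A = Fintype.card σ + 1 := by rw [Fintype.card_coe, hA]
  have : Nonempty A := Fintype.card_pos_iff.1 (by omega)
  have := Nat.le_of_mul_le_mul_right hcount Fintype.card_pos
  omega

end BiasedGraph

/-! ### Thick cycles -/

namespace BiasedGraph

open Graph
open scoped Fin.NatCast Fin.CommRing

lemma partialProd_last {M : Type*} [Monoid M] {n : ℕ} (a : Fin n → M) :
    Fin.partialProd a (Fin.last n) = (List.ofFn a).prod := by
  rw [Fin.partialProd, Fin.val_last, List.take_of_length_le (List.length_ofFn).le]

lemma mul_prod_ofFn_of_forall_mul_eq {M : Type*} [Monoid M] {n : ℕ} {a : Fin n → M}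
    {q : Fin (n + 1) → M} (hq : ∀ i : Fin n, q i.castSucc * a i = q i.succ) :
    q 0 * (List.ofFn a).prod = q (Fin.last n) := by
  have hpartial : ∀ j, q 0 * Fin.partialProd a j = q j := by
    intro j
    induction j using Fin.induction with
    | zero => rw [Fin.partialProd_zero, mul_one]
    | succ i ih => rw [Fin.partialProd_succ, ← mul_assoc, ih, hq]
  rw [← partialProd_last, hpartial]

lemma exists_forall_mul_eq_add_one_iff {Γ : Type*} [Group Γ] {n : ℕ} (a : Fin (n + 1) → Γ) :
    (∃ p : Fin (n + 1) → Γ, ∀ i, p i * a i = p (i + 1)) ↔ (List.ofFn a).prod = 1 := by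
  constructor
  · rintro ⟨p, hp⟩
    have hcycle := mul_prod_ofFn_of_forall_mul_eq (a := a)
      (q := fun j : Fin (n + 2) ↦ p (j.val : Fin (n + 1))) fun i ↦ by simpa using hp i
    simpa using hcycle
  · intro ha
    refine ⟨fun i ↦ Fin.partialProd a i.castSucc, fun i ↦ ?_⟩
    rw [← Fin.partialProd_succ]
    induction i using Fin.lastCases with
    | last =>
      rw [Fin.succ_last, partialProd_last, ha, Fin.last_add_one]
      exact (Fin.partialProd_zero a).symm
    | cast i => rw [Fin.coeSucc_eq_succ, Fin.succ_castSucc]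

lemma eq_univ_of_forall_add_one_mem {n : ℕ} {S : Set (Fin (n + 1))} (hne : S.Nonempty)
    (hS : ∀ i ∈ S, i + 1 ∈ S) : S = Set.univ := by
  obtain ⟨i, hi⟩ := hne
  have hadd : ∀ m : ℕ, i + (m : Fin (n + 1)) ∈ S := by
    intro m
    induction m with
    | zero => simpa using hi
    | succ m ih =>
      rw [Nat.cast_succ, ← add_assoc]
      exact hS _ ih
  refine Set.eq_univ_of_forall fun j ↦ ?_
  simpa using hadd (j - i).val

variable {r : ℕ} {D : Type*} {e : Fin (r + 3) × D} {i x y : Fin (r + 3)}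
  {w w' : Fin (r + 3) → D} {W W' : Set (Fin (r + 3) → D)} {C : Set (Fin (r + 3) × D)}

/-- The cycle on `r + 3` vertices in which each edge is replaced by a class of parallel edges
indexed by `D`: the edge `(i, d)` joins `i` and `i + 1`. -/
def thickCycle (r : ℕ) (D : Type*) : Graph (Fin (r + 3)) (Fin (r + 3) × D) where
  vertexSet := Set.univ
  edgeSet := Set.univ
  IsLink e x y := (x = e.1 ∧ y = e.1 + 1) ∨ (x = e.1 + 1 ∧ y = e.1)
  isLink_symm _ _ := ⟨fun _ _ h ↦ h.symm.imp And.symm And.symm⟩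
  eq_or_eq_of_isLink_of_isLink := by
    rintro e x y v w (⟨rfl, rfl⟩ | ⟨rfl, rfl⟩) (⟨rfl, rfl⟩ | ⟨rfl, rfl⟩) <;> simp
  edge_mem_iff_exists_isLink e := by
    simp only [Set.mem_univ, true_iff]
    exact ⟨_, _, Or.inl ⟨rfl, rfl⟩⟩
  left_mem_of_isLink := by simp

lemma isLink_self_add_one (e : Fin (r + 3) × D) : (thickCycle r D).IsLink e e.1 (e.1 + 1) :=
  Or.inl ⟨rfl, rfl⟩

instance : (thickCycle r D).Loopless where
  not_isLoopAt e x := by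
    rintro (⟨h, h'⟩ | ⟨h, h'⟩)
    · simpa using h'.symm.trans h
    · simpa using h.symm.trans h'

lemma thickCycle_adj [Nonempty D] : (thickCycle r D).Adj x y ↔ y = x + 1 ∨ x = y + 1 := by
  have d := Classical.arbitrary D
  constructor
  · rintro ⟨e, ⟨rfl, rfl⟩ | ⟨rfl, rfl⟩⟩ <;> simp
  · rintro (rfl | rfl)
    · exact ⟨(x, d), isLink_self_add_one _⟩
    · exact ⟨(y, d), (isLink_self_add_one _).symm⟩

/-- The simplification of a thick cycle is a cycle. -/
def thickCycleToSimpleGraphIso (r : ℕ) (D : Type*) [Nonempty D] :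
    (thickCycle r D).toSimpleGraph ≃g SimpleGraph.cycleGraph (r + 3) where
  toEquiv := Equiv.Set.univ _
  map_rel_iff' := by
    rintro ⟨x, hx⟩ ⟨y, hy⟩
    rw [toSimpleGraph_adj_iff, thickCycle_adj]
    change (SimpleGraph.cycleGraph (r + 1 + 2)).Adj x y ↔ _
    rw [SimpleGraph.cycleGraph_adj, sub_eq_iff_eq_add', sub_eq_iff_eq_add', or_comm,
      add_comm y, add_comm x]

lemma thickCycle_isLink_self_add_one : (thickCycle r D).IsLink e i (i + 1) ↔ e.1 = i := by
  refine ⟨?_, fun h ↦ h ▸ isLink_self_add_one e⟩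
  rintro (⟨h, -⟩ | ⟨rfl, h⟩)
  · exact h.symm
  · have htwo : (1 + 1 : Fin (r + 3)) = 0 := by rwa [add_assoc, add_eq_left] at h
    have := congrArg Fin.val htwo
    rw [Fin.val_add, Fin.val_one, Nat.mod_eq_of_lt (by omega)] at this
    cases this

lemma ncard_setOf_isLink [Nonempty D] (h : (thickCycle r D).Adj x y) :
    {e | (thickCycle r D).IsLink e x y}.ncard = Nat.card D := by
  have hclass : ∀ i, {e | (thickCycle r D).IsLink e i (i + 1)}.ncard = Nat.card D := by
    intro i
    have himage : {e | (thickCycle r D).IsLink e i (i + 1)} = Set.range (Prod.mk i) := by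
      ext ⟨j, d⟩
      simp [thickCycle_isLink_self_add_one, eq_comm]
    rw [himage, ← Set.image_univ, Set.ncard_image_of_injective _ (Prod.mk_right_injective i),
      Set.ncard_univ]
  rcases thickCycle_adj.1 h with rfl | rfl
  · exact hclass x
  · simp_rw [(thickCycle r D).isLink_comm]
    exact hclass y

/-- The edge set of the Hamiltonian cycle of the thick cycle that uses the edge `(i, w i)` of the
`i`-th class. -/
def wordSet (w : Fin (r + 3) → D) : Set (Fin (r + 3) × D) := {e | w e.1 = e.2}

lemma mem_wordSet : e ∈ wordSet w ↔ w e.1 = e.2 := Iff.rfl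

lemma wordSet_injective : Function.Injective (wordSet (r := r) (D := D)) := by
  intro w w' h
  ext i
  have hi : (i, w i) ∈ wordSet w' := h ▸ mem_wordSet.2 rfl
  exact hi.symm

lemma isCycle_wordSet (w : Fin (r + 3) → D) : (thickCycle r D).IsCycle (wordSet w) := by
  let step : Fin (r + 3) → (Fin (r + 3) × D) × Fin (r + 3) := fun i ↦ ((i, w i), i + 1)
  have hwalk : ∀ m : ℕ, (thickCycle r D).IsWalk 0
      ((List.range m).map fun i : ℕ ↦ step (i : Fin (r + 3))) (m : Fin (r + 3)) := by
    intro m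
    induction m with
    | zero => exact ⟨Set.mem_univ _, by simp⟩
    | succ m ih =>
      rw [List.range_succ, List.map_append]
      exact ih.append ⟨isLink_self_add_one _, Set.mem_univ _, by simp⟩
  have hrange : (List.finRange (r + 3)).map step =
      (List.range (r + 3)).map fun i : ℕ ↦ step (i : Fin (r + 3)) := by
    simp [← List.map_coe_finRange_eq_range, Function.comp_def]
  refine ⟨0, (List.finRange (r + 3)).map step, ⟨?_, by simp, ?_, ?_⟩, ?_⟩
  · rw [hrange]
    simpa using hwalk (r + 3)
  · rw [List.map_map]
    exact (List.nodup_finRange _).map fun i j h ↦ congrArg Prod.fst h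
  · rw [List.map_map]
    exact (List.nodup_finRange _).map (add_left_injective 1)
  · ext ⟨i, d⟩
    simp [stepEdges, step, mem_wordSet]

lemma endSet_wordSet (w : Fin (r + 3) → D) : endSet (thickCycle r D) (wordSet w) = Set.univ :=
  Set.eq_univ_of_forall fun i ↦ ⟨(i, w i), rfl, i + 1, isLink_self_add_one _⟩

lemma exists_eq_wordSet (hC : (thickCycle r D).IsCycle C)
    (hinj : Set.InjOn Prod.fst C) : ∃ w, wordSet w = C := by
  have hends : Prod.fst '' C = endSet (thickCycle r D) C := by
    refine Set.eq_of_subset_of_ncard_le ?_ (by rw [hC.ncard_endSet, hinj.ncard_image])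
      (Set.toFinite _)
    rintro _ ⟨e, he, rfl⟩
    exact ⟨e, he, _, isLink_self_add_one e⟩
  have huniv : Prod.fst '' C = Set.univ := by
    refine eq_univ_of_forall_add_one_mem (hC.nonempty.image _) ?_
    rintro _ ⟨e, he, rfl⟩
    rw [hends]
    exact ⟨e, he, _, (isLink_self_add_one e).symm⟩
  have hmem : ∀ i, ∃ d, (i, d) ∈ C := by
    intro i
    obtain ⟨⟨j, d⟩, he, rfl⟩ := huniv.symm ▸ Set.mem_univ i
    exact ⟨d, he⟩
  choose w hw using hmem
  refine ⟨w, ?_⟩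
  ext e
  refine ⟨fun h ↦ ?_, fun h ↦ congrArg Prod.snd (hinj (hw e.1) h rfl)⟩
  rw [← Prod.mk.eta (p := e), ← mem_wordSet.1 h]
  exact hw e.1

section Labellings

variable {Γ : Type*} [Group Γ]

lemma wordSet_mem_balancedCycles_iff (φ : (thickCycle r D).GroupLabelling Γ)
    (w : Fin (r + 3) → D) :
    wordSet w ∈ φ.balancedCycles ↔ (List.ofFn fun i ↦ φ.stepValue (i, w i) i).prod = 1 := by
  rw [GroupLabelling.mem_balancedCycles_iff, and_iff_right (isCycle_wordSet w),
    ← exists_forall_mul_eq_add_one_iff]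
  refine exists_congr fun p ↦ ⟨fun hp i ↦ ?_, ?_⟩
  · exact (GroupLabelling.mul_stepValue_eq_iff (isLink_self_add_one _)).2 (hp (i, w i) rfl)
  · rintro hp ⟨i, d⟩ (rfl : w i = d)
    exact (GroupLabelling.mul_stepValue_eq_iff (isLink_self_add_one _)).1 (hp i)

/-- The labelling of a thick cycle in which every edge is directed along the cycle and the edge
`(i, d)` has the label `B i d`. -/
def forwardLabelling (B : Fin (r + 3) → D → Γ) : (thickCycle r D).GroupLabelling Γ where
  tail e := e.1
  head e := e.1 + 1
  isLink e _ := isLink_self_add_one e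
  label e := B e.1 e.2

/-- The thick cycle with the Hamiltonian cycles given by the words in `W` as its balanced
cycles. -/
def wordGraph (W : Set (Fin (r + 3) → D)) : MarkedGraph (Fin (r + 3)) (Fin (r + 3) × D) where
  graph := thickCycle r D
  balanced := wordSet '' W

lemma wordGraph_labellable {B : Fin (r + 3) → D → Γ} (hB : ∀ i, (B i).Injective)
    (hW : ∀ w, w ∈ W ↔ (List.ofFn fun i ↦ B i (w i)).prod = 1) : (wordGraph W).Labellable Γ := by
  have hword : ∀ w, wordSet w ∈ (forwardLabelling B).balancedCycles ↔ w ∈ W := by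
    intro w
    rw [wordSet_mem_balancedCycles_iff, hW]
    simp [GroupLabelling.stepValue, forwardLabelling]
  refine ⟨forwardLabelling B, Set.Subset.antisymm (fun C hC ↦ ?_) ?_⟩
  · obtain ⟨hcycle, p, hp⟩ := GroupLabelling.mem_balancedCycles_iff.1 hC
    have hinj : Set.InjOn Prod.fst C := by
      rintro ⟨i, d⟩ hd ⟨j, d'⟩ hd' (rfl : i = j)
      exact Prod.ext rfl (hB i (mul_left_cancel ((hp _ hd).trans (hp _ hd').symm)))
    obtain ⟨w, rfl⟩ := exists_eq_wordSet hcycle hinj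
    exact ⟨w, (hword w).1 hC, rfl⟩
  · rintro _ ⟨w, hw, rfl⟩
    exact (hword w).2 hw

end Labellings

lemma _root_.Graph.IsTheta.eq_nil_of_isLink {α β : Type*} {G : Graph α β} {x y : α}
    {P Q R : List (β × α)} {q : β × α} {f : β} (h : G.IsTheta x y P (q :: Q) R)
    (hf : f ∈ stepEdges R) (hl : G.IsLink f x q.2) : Q = [] := by
  have hq : q.2 ≠ x := fun hx ↦ (List.nodup_cons.1 h.isPath₂.vertices_nodup).1 (by simp [hx])
  have hR : q.2 ∈ R.map Prod.snd :=
    (List.mem_cons.1 (h.isPath₃.isWalk.mem_of_mem_endSet ⟨f, hf, hl.inc_right⟩)).resolve_left hq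
  have hqy : q.2 = y := h.disjoint₂₃.2 _ (by simp) hR
  have hQ := h.isPath₂.tail
  rw [hqy] at hQ
  exact hQ.eq_nil

lemma exists_forall_ne_of_isTheta {P Q R : List ((Fin (r + 3) × D) × Fin (r + 3))}
    (h : (thickCycle r D).IsTheta x y P Q R) (hw : stepEdges P ∪ stepEdges Q = wordSet w)
    (hw' : stepEdges P ∪ stepEdges R = wordSet w') :
    w ≠ w' ∧ ∃ i, ∀ j ≠ i, w j = w' j := by
  obtain _ | ⟨⟨⟨i, d⟩, z⟩, Q⟩ := Q
  · exact absurd h.isPath₂.isWalk.2 h.ne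
  have hiw : (i, d) ∈ wordSet w := hw ▸ Set.mem_union_right _ (by simp)
  obtain rfl : w i = d := hiw
  have hiP : ∀ d', (i, d') ∉ stepEdges P := by
    intro d' hd'
    obtain rfl : w i = d' := (hw ▸ Set.mem_union_left _ hd' : (i, d') ∈ wordSet w)
    exact Set.disjoint_left.1 h.disjoint₁₂.1 hd' (by simp)
  have hiR : (i, w' i) ∈ stepEdges R := by
    have hi : (i, w' i) ∈ stepEdges P ∪ stepEdges R := hw'.symm ▸ mem_wordSet.2 rfl
    exact hi.resolve_left (hiP _)
  obtain rfl : Q = [] := h.eq_nil_of_isLink hiR h.isPath₂.isWalk.1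
  refine ⟨?_, i, fun j hj ↦ ?_⟩
  · rintro rfl
    exact Set.disjoint_left.1 h.disjoint₂₃.1 (by simp) hiR
  · have hjw : (j, w j) ∈ stepEdges P ∪ stepEdges [((i, w i), z)] := hw.symm ▸ mem_wordSet.2 rfl
    have hjP : (j, w j) ∈ stepEdges P := hjw.resolve_right (by simp [hj])
    exact (hw' ▸ Set.mem_union_left _ hjP : (j, w j) ∈ wordSet w').symm

lemma wordGraph_isBiased [Finite D]
    (hW : ∀ w ∈ W, ∀ w' ∈ W, ∀ i, (∀ j ≠ i, w j = w' j) → w = w') :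
    (wordGraph W).IsBiased where
  finite_vertexSet := Set.toFinite _
  finite_edgeSet := Set.toFinite _
  isCycle := by
    rintro _ ⟨w, -, rfl⟩
    exact isCycle_wordSet w
  theta := by
    rintro x y P Q R h ⟨w, hw, hPQ⟩ ⟨w', hw', hPR⟩
    obtain ⟨hne, i, hi⟩ := exists_forall_ne_of_isTheta h hPQ.symm hPR.symm
    exact absurd (hW w hw w' hw' i hi) hne

lemma wordGraph_delete_congr (h : ∀ w, w e.1 ≠ e.2 → (w ∈ W ↔ w ∈ W')) :
    (wordGraph W).delete e = (wordGraph W').delete e := by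
  refine congrArg (MarkedGraph.mk _) (Set.ext fun C ↦ and_congr_left fun he ↦ ?_)
  refine exists_congr fun w ↦ and_congr_left ?_
  rintro rfl
  exact h w he

lemma wordGraph_contractLink_congr (hxy : x ≠ y) (h : ∀ w, w e.1 = e.2 → (w ∈ W ↔ w ∈ W')) :
    (wordGraph W).contractLink e x y = (wordGraph W').contractLink e x y := by
  refine congrArg (MarkedGraph.mk _) (Set.ext fun C ↦ and_congr_right fun hC ↦ ?_)
  have hword : ∀ w, wordSet w ≠ C := by
    rintro w rfl
    have hends : x ∉ endSet (thickCycle r D) (wordSet w) ∨ y ∉ endSet _ (wordSet w) :=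
      notMem_endSet_of_isCycle_contractLink hC (isCycle_wordSet w) hxy
    simp [endSet_wordSet] at hends
  refine or_congr (exists_congr fun w ↦ ?_) (exists_congr fun w ↦ and_congr_left fun hw ↦ ?_)
  · simp only [hword w, and_false]
  · exact h w (mem_wordSet.1 (hw ▸ Set.mem_union_right _ rfl))

end BiasedGraph

/-! ### Switching -/

namespace BiasedGraph

open scoped Fin.NatCast Fin.CommRing

lemma apply_eq_of_prod_ofFn_eq {Γ : Type*} [Group Γ] {n : ℕ} {a b : Fin n → Γ} {i : Fin n}
    (h : ∀ j ≠ i, a j = b j) (hprod : (List.ofFn a).prod = (List.ofFn b).prod) : a i = b i := by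
  induction n with
  | zero => exact i.elim0
  | succ n ih =>
    rw [List.ofFn_succ, List.ofFn_succ, List.prod_cons, List.prod_cons] at hprod
    cases i using Fin.cases with
    | zero =>
      have htail : (fun j : Fin n ↦ a j.succ) = fun j ↦ b j.succ :=
        funext fun j ↦ h _ j.succ_ne_zero
      rw [htail] at hprod
      exact mul_right_cancel hprod
    | succ i =>
      rw [h 0 i.succ_ne_zero.symm] at hprod
      exact ih (fun j hj ↦ h _ (by simpa using hj)) (mul_left_cancel hprod)

section Switching

variable {n : ℕ} {D V Γ : Type*} [Group Γ] {tail head : Fin (n + 2) → D → V}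
  {A : Fin (n + 2) → D → Γ} {X : Fin (n + 2) × V → Γ} {i : Fin (n + 2)} {d d' : D}
  {w : Fin (n + 2) → D} {c : Fin (n + 2) × V} {g : Γ}

/-- Let the vertex `i` of the thick cycle be split into joints `(i, v)`, and let the `d`-th edge of
the `i`-th class run from the joint `(i, tail i d)` to `(i + 1, head i d)`. This is the labelling
`A` of the resulting graph, switched at every joint `c` by `X c`. -/
def switch (tail head : Fin (n + 2) → D → V) (A : Fin (n + 2) → D → Γ)
    (X : Fin (n + 2) × V → Γ) (i : Fin (n + 2)) (d : D) : Γ :=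
  (X (i, tail i d))⁻¹ * A i d * X (i + 1, head i d)

/-- The edges chosen by the word `w` form a closed walk already in the graph with split
vertices. -/
def IsMatched (tail head : Fin (n + 2) → D → V) (w : Fin (n + 2) → D) : Prop :=
  ∀ i, head i (w i) = tail (i + 1) (w (i + 1))

lemma prod_switch_eq_one_iff (hw : IsMatched tail head w) :
    (List.ofFn fun i ↦ switch tail head A X i (w i)).prod = 1 ↔
      (List.ofFn fun i ↦ A i (w i)).prod = 1 := by
  rw [← exists_forall_mul_eq_add_one_iff, ← exists_forall_mul_eq_add_one_iff]
  constructor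
  · rintro ⟨p, hp⟩
    refine ⟨fun i ↦ p i * (X (i, tail i (w i)))⁻¹, fun i ↦ ?_⟩
    beta_reduce
    rw [← hp, switch, ← hw i]
    group
  · rintro ⟨p, hp⟩
    refine ⟨fun i ↦ p i * X (i, tail i (w i)), fun i ↦ ?_⟩
    beta_reduce
    rw [← hp, switch, ← hw i]
    group

variable [DecidableEq V]

lemma switch_update_of_ne (htail : c ≠ (i, tail i d)) (hhead : c ≠ (i + 1, head i d)) :
    switch tail head A (Function.update X c g) i d = switch tail head A X i d := by
  rw [switch, switch, Function.update_of_ne htail.symm, Function.update_of_ne hhead.symm]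

lemma eq_of_switch_update_tail_eq
    (h : switch tail head A (Function.update X (i, tail i d) g) i d = switch tail head A X i d) :
    g = X (i, tail i d) := by
  have hne : (i + 1, head i d) ≠ (i, tail i d) := by simp
  rw [switch, switch, Function.update_self, Function.update_of_ne hne] at h
  simpa using h

lemma eq_of_switch_update_head_eq
    (h : switch tail head A (Function.update X (i + 1, head i d) g) i d =
      switch tail head A X i d) : g = X (i + 1, head i d) := by
  have hne : (i, tail i d) ≠ (i + 1, head i d) := by simp
  rw [switch, switch, Function.update_self, Function.update_of_ne hne] at h
  simpa using h

lemma exists_forall_prod_switch_update (hw : ¬ IsMatched tail head w) :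
    ∃ c, ∀ (X : Fin (n + 2) × V → Γ) g,
      (List.ofFn fun i ↦ switch tail head A X i (w i)).prod = 1 →
      (List.ofFn fun i ↦ switch tail head A (Function.update X c g) i (w i)).prod = 1 →
      g = X c := by
  obtain ⟨i, hi⟩ := not_forall.1 hw
  refine ⟨(i + 1, tail (i + 1) (w (i + 1))), fun X g h h' ↦
    eq_of_switch_update_tail_eq (head := head) (A := A) ?_⟩
  refine apply_eq_of_prod_ofFn_eq (i := i + 1) (fun j hj ↦ ?_) (h'.trans h.symm)
  refine switch_update_of_ne (fun h ↦ hj (congrArg Prod.fst h).symm) fun h ↦ hi ?_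
  obtain rfl : i = j := add_right_cancel (congrArg Prod.fst h)
  exact (congrArg Prod.snd h).symm

lemma exists_forall_switch_update (hinj : (fun d ↦ (tail i d, head i d)).Injective)
    (hd : d ≠ d') : ∃ c, ∀ (X : Fin (n + 2) × V → Γ) g,
      switch tail head A X i d = switch tail head A X i d' →
      switch tail head A (Function.update X c g) i d =
        switch tail head A (Function.update X c g) i d' → g = X c := by
  by_cases htail : tail i d = tail i d'
  · have hhead : head i d ≠ head i d' := fun h ↦ hd (hinj (Prod.ext htail h))
    refine ⟨(i + 1, head i d), fun X g h h' ↦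
      eq_of_switch_update_head_eq (tail := tail) (A := A) ?_⟩
    rw [h', switch_update_of_ne (by simp) (by simpa using hhead), h]
  · refine ⟨(i, tail i d), fun X g h h' ↦
      eq_of_switch_update_tail_eq (head := head) (A := A) ?_⟩
    rw [h', switch_update_of_ne (by simpa using htail) (by simp), h]

end Switching

lemma exists_injective_forall_prod_eq_one_iff {n : ℕ} {D V Γ : Type*} [Finite D] [Finite V]
    [Group Γ] [Infinite Γ] {tail head : Fin (n + 2) → D → V} (A : Fin (n + 2) → D → Γ)
    (hinj : ∀ i, (fun d ↦ (tail i d, head i d)).Injective) :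
    ∃ B : Fin (n + 2) → D → Γ, (∀ i, (B i).Injective) ∧ ∀ w,
      (List.ofFn fun i ↦ B i (w i)).prod = 1 ↔
        IsMatched tail head w ∧ (List.ofFn fun i ↦ A i (w i)).prod = 1 := by
  classical
  let P : {w // ¬ IsMatched tail head w} ⊕ {x : Fin (n + 2) × D × D // x.2.1 ≠ x.2.2} →
      (Fin (n + 2) × V → Γ) → Prop
    | .inl w, X => (List.ofFn fun i ↦ switch tail head A X i (w.1 i)).prod = 1
    | .inr x, X => switch tail head A X x.1.1 x.1.2.1 = switch tail head A X x.1.1 x.1.2.2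
  obtain ⟨X, hX⟩ := exists_forall_not_of_update P <| by
    rintro (w | x)
    · exact exists_forall_prod_switch_update w.2
    · exact exists_forall_switch_update (hinj _) x.2
  refine ⟨switch tail head A X, fun i d d' h ↦ ?_, fun w ↦ ?_⟩
  · by_contra hd
    exact hX (.inr ⟨(i, d, d'), hd⟩) h
  · by_cases hw : IsMatched tail head w
    · rw [and_iff_right hw, prod_switch_eq_one_iff hw]
    · exact iff_of_false (hX (.inl ⟨w, hw⟩)) (hw ·.1)

end BiasedGraph

/-! ### The bipyramid -/

namespace Bipyramid

open Graph BiasedGraph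
open scoped Fin.NatCast Fin.CommRing

variable {r n : ℕ} {i : Fin (r + 3)} {K K' : Set (Bool × (Bool × Fin (n + 2)))}

/-- The edges of a polygon with `2 * (n + 2)` sides, alternately of the form `(false, j)` and
`(true, j)`. Its vertices fall into two classes indexed by `Fin (n + 2)`: the edge `d` joins the
vertex `d.2` of the first class to the vertex `shift d` of the second. -/
abbrev Index (n : ℕ) : Type := Bool × Fin (n + 2)

/-- The end in the second class of an edge of the polygon. -/
def shift (d : Index n) : Fin (n + 2) := if d.1 then d.2 + 1 else d.2

/-- The boundary of the face `s = (a, d)` of the bipyramid, where `a` is one of the two apices and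
`d` an edge of the polygon: up from the vertex `d.2` to `a`, down from `a` to `shift d`, and back
along `d`, which is subdivided `r` times. -/
def face (s : Bool × Index n) (i : Fin (r + 3)) : Index n :=
  if i = 0 then (s.1, s.2.2) else if i = 1 then (s.1, shift s.2) else s.2

/-- The distinguished face of the bipyramid, which is going to be the only unbalanced one. -/
def hole (n : ℕ) : Bool × Index n := (true, false, 0)

lemma eq_of_shift_eq {d d' : Index n} (hshift : shift d = shift d') (hd : d.2 = d'.2) :
    d = d' := by
  obtain ⟨a, j⟩ := d
  obtain ⟨a', j'⟩ := d'
  obtain rfl : j = j' := hd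
  cases a <;> cases a' <;> simp [shift] at hshift ⊢

@[simp] lemma face_zero (s : Bool × Index n) : face (r := r) s 0 = (s.1, s.2.2) := if_pos rfl

@[simp] lemma face_one (s : Bool × Index n) : face (r := r) s 1 = (s.1, shift s.2) := by
  simp [face]

lemma face_of_ne (s : Bool × Index n) (h₀ : i ≠ 0) (h₁ : i ≠ 1) : face s i = s.2 := by
  rw [face, if_neg h₀, if_neg h₁]

lemma fin_two_ne_zero : (2 : Fin (r + 3)) ≠ 0 := two_ne_zero

lemma fin_two_ne_one : (2 : Fin (r + 3)) ≠ 1 := by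
  rw [Ne, Fin.ext_iff, Fin.val_one, Fin.val_two]
  norm_num

@[simp] lemma face_two (s : Bool × Index n) : face (r := r) s 2 = s.2 :=
  face_of_ne s fin_two_ne_zero fin_two_ne_one

lemma eq_of_forall_ne_face_eq {s s' : Bool × Index n} (i : Fin (r + 3))
    (h : ∀ j ≠ i, face s j = face s' j) : s = s' := by
  by_cases h₂ : i = 2
  · have hzero := h 0 (h₂ ▸ fin_two_ne_zero.symm)
    have hone := h 1 (h₂ ▸ fin_two_ne_one.symm)
    simp only [face_zero, face_one, Prod.mk.injEq] at hzero hone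
    exact Prod.ext hzero.1 (eq_of_shift_eq hone.2 hzero.2)
  · refine Prod.ext ?_ (by simpa using h 2 (Ne.symm h₂))
    by_cases h₀ : i = 0
    · simpa using congrArg Prod.fst (h 1 (by simp [h₀]))
    · simpa using congrArg Prod.fst (h 0 (Ne.symm h₀))

lemma face_injective : (face (r := r) (n := n)).Injective := fun _ _ h ↦
  eq_of_forall_ne_face_eq 0 fun j _ ↦ congrFun h j

/-- The thick cycle whose balanced cycles are the boundaries of the faces in `K`. -/
def faceGraph (r : ℕ) (K : Set (Bool × Index n)) :
    MarkedGraph (Fin (r + 3)) (Fin (r + 3) × Index n) :=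
  wordGraph (face '' K)

lemma faceGraph_isBiased : (faceGraph r K).IsBiased := by
  refine wordGraph_isBiased ?_
  rintro _ ⟨s, -, rfl⟩ _ ⟨s', -, rfl⟩ i h
  rw [eq_of_forall_ne_face_eq i h]

lemma faceGraph_delete_congr {e : Fin (r + 3) × Index n}
    (h : ∀ s, face s e.1 ≠ e.2 → (s ∈ K ↔ s ∈ K')) :
    (faceGraph r K).delete e = (faceGraph r K').delete e := by
  refine wordGraph_delete_congr fun w hw ↦ exists_congr fun s ↦ and_congr_left ?_
  rintro rfl
  exact h s hw

lemma faceGraph_contractLink_congr {e : Fin (r + 3) × Index n} {x y : Fin (r + 3)} (hxy : x ≠ y)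
    (h : ∀ s, face s e.1 = e.2 → (s ∈ K ↔ s ∈ K')) :
    (faceGraph r K).contractLink e x y = (faceGraph r K').contractLink e x y := by
  refine wordGraph_contractLink_congr hxy fun w hw ↦ exists_congr fun s ↦ and_congr_left ?_
  rintro rfl
  exact h s hw

lemma prod_face {M : Type*} [Monoid M] (A : Fin (r + 3) → Index n → M) (s : Bool × Index n) :
    (List.ofFn fun i ↦ A i (face s i)).prod =
      A 0 (s.1, s.2.2) * A 1 (s.1, shift s.2) *
        (List.ofFn fun i : Fin (r + 1) ↦ A i.succ.succ s.2).prod := by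
  have hface : ∀ i : Fin (r + 1), face s i.succ.succ = s.2 := fun i ↦
    face_of_ne s (Fin.succ_ne_zero _) (Fin.succ_succ_ne_one i)
  rw [List.ofFn_succ, List.ofFn_succ, List.prod_cons, List.prod_cons, mul_assoc]
  simp only [hface, face_zero, Fin.succ_zero_eq_one, face_one]

/-- The vertex of the bipyramid at which the edge `d` of the `i`-th class starts. The vertices at
position `0` are coded as `(false, j)`, the apices as `(a, 0)`, and the vertices at position `2` as
`(false, j)`; those that subdivide the edge `d` of the polygon are coded as `d`. -/
def tail (i : Fin (r + 3)) (d : Index n) : Index n :=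
  if i = 0 then (false, d.2) else if i = 1 then (d.1, 0) else
    if i = 2 then (false, shift d) else d

/-- The vertex of the bipyramid at which the edge `d` of the `i`-th class ends, coded as in
`tail`. -/
def head (i : Fin (r + 3)) (d : Index n) : Index n :=
  if i = 1 then (false, d.2) else tail (i + 1) d

@[simp] lemma tail_zero (d : Index n) : tail (r := r) 0 d = (false, d.2) := if_pos rfl

@[simp] lemma tail_one (d : Index n) : tail (r := r) 1 d = (d.1, 0) := by simp [tail]

@[simp] lemma tail_two (d : Index n) : tail (r := r) 2 d = (false, shift d) := by
  simp [tail, fin_two_ne_zero, fin_two_ne_one]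

lemma tail_of_ne (d : Index n) (h₀ : i ≠ 0) (h₁ : i ≠ 1) (h₂ : i ≠ 2) : tail i d = d := by
  rw [tail, if_neg h₀, if_neg h₁, if_neg h₂]

@[simp] lemma head_zero (d : Index n) : head (r := r) 0 d = (d.1, 0) := by simp [head]

@[simp] lemma head_one (d : Index n) : head (r := r) 1 d = (false, d.2) := if_pos rfl

lemma head_of_ne (d : Index n) (h₁ : i ≠ 1) : head i d = tail (i + 1) d := if_neg h₁

lemma snd_eq_of_head_eq {d d' : Index n} (h₀ : i ≠ 0) (h₁ : i ≠ 1) (h : head i d = head i d') :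
    d.2 = d'.2 := by
  have hone : i + 1 ≠ 1 := by simpa using h₀
  have htwo : i + 1 ≠ 2 := fun h ↦ h₁ (add_right_cancel (h.trans one_add_one_eq_two.symm))
  rw [head_of_ne _ h₁, head_of_ne _ h₁] at h
  by_cases hzero : i + 1 = 0
  · rw [hzero, tail_zero, tail_zero] at h
    exact (Prod.mk.inj h).2
  · rw [tail_of_ne _ hzero hone htwo, tail_of_ne _ hzero hone htwo] at h
    rw [h]

lemma tail_head_injective (i : Fin (r + 3)) :
    (fun d : Index n ↦ (tail i d, head i d)).Injective := by
  intro d d' h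
  obtain ⟨htail, hhead⟩ := Prod.mk.inj h
  by_cases h₀ : i = 0
  · rw [h₀, tail_zero, tail_zero] at htail
    rw [h₀, head_zero, head_zero] at hhead
    exact Prod.ext (Prod.mk.inj hhead).1 (Prod.mk.inj htail).2
  by_cases h₁ : i = 1
  · rw [h₁, tail_one, tail_one] at htail
    rw [h₁, head_one, head_one] at hhead
    exact Prod.ext (Prod.mk.inj htail).1 (Prod.mk.inj hhead).2
  by_cases h₂ : i = 2
  · rw [h₂, tail_two, tail_two] at htail
    exact eq_of_shift_eq (Prod.mk.inj htail).2 (snd_eq_of_head_eq h₀ h₁ hhead)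
  · rwa [tail_of_ne _ h₀ h₁ h₂, tail_of_ne _ h₀ h₁ h₂] at htail

lemma isMatched_face (s : Bool × Index n) : IsMatched tail head (face (r := r) s) := by
  intro i
  by_cases h₀ : i = 0
  · simp [h₀]
  by_cases h₁ : i = 1
  · simp [h₁, one_add_one_eq_two]
  rw [head_of_ne _ h₁, face_of_ne s h₀ h₁]
  by_cases hzero : i + 1 = 0
  · simp [hzero]
  · rw [face_of_ne s hzero (by simpa using h₀)]

lemma apply_eq_of_isMatched {w : Fin (r + 3) → Index n} (hw : IsMatched tail head w)
    (i : Fin (r + 3)) : i = 0 ∨ i = 1 ∨ w i = w 2 := by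
  refine Set.eq_univ_iff_forall.1 (eq_univ_of_forall_add_one_mem
    (S := {i | i = 0 ∨ i = 1 ∨ w i = w 2}) ⟨2, Or.inr (Or.inr rfl)⟩ ?_) i
  rintro i (rfl | rfl | hi)
  · exact Or.inr (Or.inl (zero_add 1))
  · exact Or.inr (Or.inr (by rw [one_add_one_eq_two]))
  by_cases hzero : i + 1 = 0
  · exact Or.inl hzero
  by_cases hone : i + 1 = 1
  · exact Or.inr (Or.inl hone)
  refine Or.inr (Or.inr ?_)
  by_cases htwo : i + 1 = 2
  · rw [htwo]
  have h₁ : i ≠ 1 := by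
    rintro rfl
    exact htwo one_add_one_eq_two
  have hjoint := hw i
  rwa [head_of_ne _ h₁, tail_of_ne _ hzero hone htwo, tail_of_ne _ hzero hone htwo, hi,
    eq_comm] at hjoint

lemma exists_face_eq_of_isMatched {w : Fin (r + 3) → Index n} (hw : IsMatched tail head w) :
    ∃ s, face s = w := by
  have hlast : w (Fin.last (r + 2)) = w 2 :=
    ((apply_eq_of_isMatched hw _).resolve_left Fin.last_pos.ne').resolve_left
      (by simp [Fin.ext_iff])
  have hzero : (w 2).2 = (w 0).2 := by
    have hjoint := hw (Fin.last (r + 2))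
    rw [head_of_ne _ (by simp [Fin.ext_iff]), Fin.last_add_one, hlast, tail_zero, tail_zero]
      at hjoint
    exact (Prod.mk.inj hjoint).2
  have hone : (w 0).1 = (w 1).1 := by simpa using hw 0
  have htwo : (w 1).2 = shift (w 2) := by simpa [one_add_one_eq_two] using hw 1
  refine ⟨((w 0).1, w 2), funext fun i ↦ ?_⟩
  by_cases h₀ : i = 0
  · rw [h₀, face_zero, hzero]
  by_cases h₁ : i = 1
  · rw [h₁, face_one, hone, ← htwo]
  · rw [face_of_ne _ h₀ h₁]
    exact (((apply_eq_of_isMatched hw i).resolve_left h₀).resolve_left h₁).symm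

lemma exists_face_eq {d : Index n} (h : face (hole n) i ≠ d) :
    ∃ s : Bool × Index n, s.2 ≠ (false, 0) ∧ face s i = d := by
  by_cases h₀ : i = 0
  · exact ⟨(d.1, true, d.2), by simp, by simp [h₀]⟩
  by_cases h₁ : i = 1
  · exact ⟨(d.1, true, d.2 - 1), by simp, by simp [h₁, shift]⟩
  · rw [face_of_ne _ h₀ h₁] at h
    exact ⟨(true, d), h.symm, face_of_ne _ h₀ h₁⟩

lemma face_hole_ne (i : Fin (r + 3)) : face (hole n) i ≠ face (false, true, 0) i := by
  by_cases h₀ : i = 0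
  · simp [h₀, hole]
  by_cases h₁ : i = 1
  · simp [h₁, hole]
  · simp [face_of_ne _ h₀ h₁, hole]

section Labellings

variable {Γ : Type*} [Group Γ]

lemma prod_hole {a b c : Index n → Γ}
    (h : ∀ s ≠ hole n, a (s.1, s.2.2) * b (s.1, shift s.2) * c s.2 = 1) :
    a ((hole n).1, (hole n).2.2) * b ((hole n).1, shift (hole n).2) * c (hole n).2 = 1 := by
  -- The two faces on an edge of the polygon are both balanced only if `p` and `q` agree at its
  -- ends, and the edges other than the base of the hole form a path through all the vertices.
  let p : Fin (n + 2) → Γ := fun j ↦ b (true, j) * (b (false, j))⁻¹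
  let q : Fin (n + 2) → Γ := fun j ↦ (a (true, j))⁻¹ * a (false, j)
  have hpq : ∀ d : Index n, a (true, d.2) * b (true, shift d) * c d = 1 ↔
      p (shift d) = q d.2 := by
    intro d
    have hc : c d = (a (false, d.2) * b (false, shift d))⁻¹ :=
      eq_inv_of_mul_eq_one_right (h (false, d) (by simp [hole]))
    rw [hc, mul_inv_rev, mul_assoc, ← mul_assoc (b _), ← mul_assoc, mul_inv_eq_one,
      eq_inv_mul_iff_mul_eq]
  have htrue : ∀ j, p (j + 1) = q j := fun j ↦
    (hpq (true, j)).1 (h (true, true, j) (by simp [hole]))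
  have hfalse : ∀ j ≠ 0, p j = q j := fun j hj ↦
    (hpq (false, j)).1 (h (true, false, j) (by simpa [hole] using hj))
  have hq : ∀ j, q j = q 0 := by
    intro j
    induction j using Fin.induction with
    | zero => rfl
    | succ i ih =>
      rw [← ih, ← hfalse _ (Fin.succ_ne_zero i), ← htrue, Fin.coeSucc_eq_succ]
  refine (hpq (false, 0)).2 ?_
  change p 0 = q 0
  rw [← hq (Fin.last _), ← htrue, Fin.last_add_one]

lemma not_labellable_faceGraph : ¬ (faceGraph r {s | s ≠ hole n}).Labellable Γ := by
  rintro ⟨φ, hφ⟩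
  change (thickCycle r (Index n)).GroupLabelling Γ at φ
  change φ.balancedCycles = wordSet '' (face '' {s | s ≠ hole n}) at hφ
  have hprod : ∀ s, wordSet (face s) ∈ φ.balancedCycles ↔ _ := fun s ↦ by
    rw [wordSet_mem_balancedCycles_iff, prod_face (fun i d ↦ φ.stepValue (i, d) i)]
  have hface : ∀ s ≠ hole n, wordSet (face s) ∈ φ.balancedCycles := by
    intro s hs
    rw [hφ]
    exact ⟨face s, ⟨s, hs, rfl⟩, rfl⟩
  have hhole : wordSet (face (hole n)) ∈ φ.balancedCycles :=
    (hprod _).2 (prod_hole (a := fun d ↦ φ.stepValue (0, d) 0) (b := fun d ↦ φ.stepValue (1, d) 1)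
      (c := fun d ↦ (List.ofFn fun i : Fin (r + 1) ↦ φ.stepValue (i.succ.succ, d) i.succ.succ).prod)
      fun s hs ↦ (hprod s).1 (hface s hs))
  rw [hφ] at hhole
  obtain ⟨_, ⟨s, hs, rfl⟩, h⟩ := hhole
  exact hs (face_injective (wordSet_injective h))

variable [Infinite Γ]

lemma labellable_of_forall_mem_iff (a b c : Index n → Γ)
    (hK : ∀ s, s ∈ K ↔ a (s.1, s.2.2) * b (s.1, shift s.2) * c s.2 = 1) :
    (faceGraph r K).Labellable Γ := by
  let A : Fin (r + 3) → Index n → Γ := fun i ↦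
    if i = 0 then a else if i = 1 then b else if i = 2 then c else 1
  have hA : ∀ s, (List.ofFn fun i ↦ A i (face s i)).prod =
      a (s.1, s.2.2) * b (s.1, shift s.2) * c s.2 := by
    intro s
    have hone : ∀ i : Fin (r + 1), i.succ.succ ≠ 1 := Fin.succ_succ_ne_one
    have hrest : ∀ i : Fin r, i.succ.succ.succ ≠ 2 := fun i ↦
      (Fin.succ_injective _).ne (Fin.succ_succ_ne_one i)
    rw [prod_face, List.ofFn_succ, List.prod_cons]
    simp [A, hone, hrest, Fin.succ_ne_zero, fin_two_ne_zero, fin_two_ne_one]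
  obtain ⟨B, hB, hprod⟩ := exists_injective_forall_prod_eq_one_iff A tail_head_injective
  refine wordGraph_labellable hB fun w ↦ ?_
  rw [hprod]
  constructor
  · rintro ⟨s, hs, rfl⟩
    exact ⟨isMatched_face s, (hA s).trans ((hK s).1 hs)⟩
  · rintro ⟨hw, hs⟩
    obtain ⟨s, rfl⟩ := exists_face_eq_of_isMatched hw
    exact ⟨s, (hK s).2 ((hA s).symm.trans hs), rfl⟩

variable (r n Γ) in
lemma labellable_univ : (faceGraph r (Set.univ : Set (Bool × Index n))).Labellable Γ :=
  labellable_of_forall_mem_iff 1 1 1 fun s ↦ by simp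

lemma exists_apply_snd_eq_apply_shift_iff {c : Index n} (hc : c ≠ (false, 0)) :
    ∃ p q : Fin (n + 2) → Γ, ∀ d : Index n,
      q d.2 = p (shift d) ↔ d ≠ c ∧ d ≠ (false, 0) := by
  obtain ⟨g, hg⟩ := exists_ne (1 : Γ)
  -- Along the polygon `(false, 0)` has rank `0` and `c` has rank `rank`; the vertices on the arc
  -- between the two get the value `g`, all others `1`.
  let rank : ℕ := 2 * c.2 + c.1.toNat
  refine ⟨fun j ↦ if 0 < j.val ∧ 2 * j.val ≤ rank then g else 1,
    fun j ↦ if 2 * j.val + 1 ≤ rank then g else 1, fun d ↦ ?_⟩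
  have hite : ∀ A B : Prop, ∀ [Decidable A] [Decidable B],
      ((if A then g else 1) = (if B then g else 1)) ↔ (A ↔ B) := by
    intro A B _ _
    by_cases hA : A <;> by_cases hB : B <;> simp [hA, hB, hg, hg.symm]
  rw [hite]
  obtain ⟨a, i⟩ := d
  obtain ⟨b, j⟩ := c
  have hj := j.isLt
  cases a <;> cases b <;>
    simp only [rank, shift, Prod.mk.injEq, ne_eq, Fin.ext_iff, Fin.val_add_one, Fin.val_zero,
      Fin.val_last, if_true, if_false, reduceCtorEq, Bool.false_eq_true, Bool.toNat_false,
      Bool.toNat_true, false_and, true_and, not_false_eq_true, and_true, iff_true] at hc ⊢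
  · omega
  · omega
  · split_ifs <;> omega
  · split_ifs <;> omega

lemma labellable_pair (e : Bool) {c : Index n} (hc : c ≠ (false, 0)) :
    (faceGraph r {s | s ≠ hole n ∧ s ≠ (e, c)}).Labellable Γ := by
  obtain ⟨p, q, hpq⟩ := exists_apply_snd_eq_apply_shift_iff (Γ := Γ) hc
  let a : Index n → Γ := fun d ↦ if d.1 then (q d.2)⁻¹ else 1
  let b : Index n → Γ := fun d ↦ if d.1 then p d.2 else 1
  let g : Index n → Γ := fun d ↦ if e = false ∧ d = c then (p (shift c))⁻¹ * q c.2 else 1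
  have hcc : q c.2 ≠ p (shift c) := fun h ↦ ((hpq c).1 h).1 rfl
  refine labellable_of_forall_mem_iff a b g ?_
  rintro ⟨e', d⟩
  by_cases h : d = c
  · subst h
    cases e <;> cases e' <;> simp [a, b, g, hole, hc, hcc, hcc.symm, inv_mul_eq_one, mul_assoc]
  · cases e <;> cases e' <;> simp [a, b, g, hole, h, hpq, inv_mul_eq_one]

lemma labellable_delete (e : Fin (r + 3) × Index n) :
    ((faceGraph r {s | s ≠ hole n}).delete e).Labellable Γ := by
  by_cases hhole : face (hole n) e.1 = e.2
  · have heq : (faceGraph r {s | s ≠ hole n}).delete e = (faceGraph r Set.univ).delete e :=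
      faceGraph_delete_congr fun s hs ↦
        iff_of_true (fun h : s = hole n ↦ hs (h ▸ hhole)) trivial
    rw [heq]
    exact (labellable_univ r n Γ).delete e
  · obtain ⟨s', hs', he⟩ := exists_face_eq hhole
    have heq : (faceGraph r {s | s ≠ hole n}).delete e =
        (faceGraph r {s | s ≠ hole n ∧ s ≠ s'}).delete e :=
      faceGraph_delete_congr fun s hs ↦ (and_iff_left fun h : s = s' ↦ hs (h ▸ he)).symm
    rw [heq]
    exact (labellable_pair s'.1 hs').delete e

lemma labellable_contractLink {e : Fin (r + 3) × Index n} {x y : Fin (r + 3)}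
    (he : (thickCycle r (Index n)).IsLink e x y) (hxy : x ≠ y) :
    ((faceGraph r {s | s ≠ hole n}).contractLink e x y).Labellable Γ := by
  by_cases hhole : face (hole n) e.1 = e.2
  · have heq : (faceGraph r {s | s ≠ hole n}).contractLink e x y =
        (faceGraph r {s | s ≠ hole n ∧ s ≠ (false, true, 0)}).contractLink e x y :=
      faceGraph_contractLink_congr hxy fun s hs ↦ (and_iff_left fun h : s = (false, true, 0) ↦
        face_hole_ne e.1 (hhole.trans (h ▸ hs.symm))).symm
    rw [heq]
    exact (labellable_pair false (by simp)).contractLink he hxy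
  · have heq : (faceGraph r {s | s ≠ hole n}).contractLink e x y =
        (faceGraph r Set.univ).contractLink e x y :=
      faceGraph_contractLink_congr hxy fun s hs ↦
        iff_of_true (fun h : s = hole n ↦ hhole (h ▸ hs)) trivial
    rw [heq]
    exact (labellable_univ r n Γ).contractLink he hxy

lemma labellable_of_hasProperMinor {l : LoopRule}
    {Ω : MarkedGraph (Fin (r + 3)) (Fin (r + 3) × Index n)}
    (h : MarkedGraph.HasProperMinor l (faceGraph r {s | s ≠ hole n}) Ω) : Ω.Labellable Γ := by
  refine h.labellable fun Ω₁ hstep ↦ ?_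
  cases hstep with
  | delete _ => exact labellable_delete _
  | contractLink he hxy => exact labellable_contractLink he hxy
  | contractBalancedLoop he _ => exact absurd he (not_isLoopAt (thickCycle r (Index n)) _ _)
  | contractUnbalancedLoop he _ => exact absurd he (not_isLoopAt (thickCycle r (Index n)) _ _)

end Labellings

end Bipyramid

theorem theorem4p2_general (k t : ℕ) (hk : 2 ≤ k) (ht : 3 ≤ t) :
    ∃ (α β : Type) (Ω : MarkedGraph α β), Ω.IsBiased ∧
      Ω.graph.Loopless ∧
      Nonempty (Ω.graph.toSimpleGraph ≃g SimpleGraph.cycleGraph t) ∧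
      (∀ x y, x ≠ y → Ω.graph.Adj x y → {e | Ω.graph.IsLink e x y}.ncard = 2 * k) ∧
      ¬ MarkedGraph.GroupLabellable.{u} Ω ∧
      ∀ (Γ : Type v) [Group Γ] [Infinite Γ] (r : LoopRule) (Ω' : MarkedGraph α β),
        MarkedGraph.HasProperMinor r Ω Ω' → Ω'.Labellable Γ := by
  obtain ⟨n, rfl⟩ := Nat.exists_eq_add_of_le' hk
  obtain ⟨r, rfl⟩ := Nat.exists_eq_add_of_le' ht
  refine ⟨_, _, Bipyramid.faceGraph r {s | s ≠ Bipyramid.hole n}, Bipyramid.faceGraph_isBiased,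
    inferInstanceAs (BiasedGraph.thickCycle r _).Loopless,
    ⟨BiasedGraph.thickCycleToSimpleGraphIso r _⟩, fun x y _ hxy ↦ ?_, ?_,
    fun Γ _ _ l Ω' ↦ Bipyramid.labellable_of_hasProperMinor⟩
  · exact (BiasedGraph.ncard_setOf_isLink hxy).trans (by simp)
  · rintro ⟨Γ, _, h⟩
    exact Bipyramid.not_labellable_faceGraph h

theorem theorem4p2 (k t : ℕ) (hk : 2 ≤ k) (ht : t = 3 ∨ 5 ≤ t) :
    ∃ (α β : Type) (Ω : MarkedGraph α β), Ω.IsBiased ∧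
      Ω.graph.Loopless ∧
      Nonempty (Ω.graph.toSimpleGraph ≃g SimpleGraph.cycleGraph t) ∧
      (∀ x y, x ≠ y → Ω.graph.Adj x y → {e | Ω.graph.IsLink e x y}.ncard = 2 * k) ∧
      ¬ MarkedGraph.GroupLabellable.{u} Ω ∧
      ∀ (Γ : Type v) [Group Γ] [Infinite Γ] (r : LoopRule) (Ω' : MarkedGraph α β),
        MarkedGraph.HasProperMinor r Ω Ω' → Ω'.Labellable Γ :=
  theorem4p2_general k t hk (by omega)
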